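/- A \emph{dyadic grid} on $\mathbb{R}$ is a collection $\mathcal{D}=\bigcup_{j\in\mathbb{Z}}\mathcal{D}_j$ of bounded intervals $[a,b)$ such that each generation $\mathcal{D}_j$ is a partition of $\mathbb{R}$ and the left and right halves $I_l,I_r$ of every $I\in\mathcal{D}_j$ belong to $\mathcal{D}_{j+1}$. For an interval $I$ let $\langle f\rangle_I=\frac1{|I|}\int_I f\,dx$ and $h_I=|I|^{-1/2}(\mathbf 1_{I_r}-\mathbf 1_{I_l})$. Functions are real or complex valued. A weight is a locally integrable function $w$ on $\mathbb{R}$ with $w>0$ a.e.; $w\in A_2$ means $[w]_{A_2}:=\sup_Q\langle w\rangle_Q\langle w^{-1}\rangle_Q<\infty$, the supremum over all bounded intervals $Q$. A measurable function $f$ is in $L^2(w)$ if $\|f\|_{L^2(w)}:=(\int|f|^2w\,dx)^{1/2}<\infty$. A locally integrable function $b$ is in $\mathrm{BMO}^{\mathcal D}$ if $\|b\|_{\mathrm{BMO}^{\mathcal D}}:=\sup_{J\in\mathcal D}\big(\frac1{|J|}\int_J|b-\langle b\rangle_J|^2dx\big)^{1/2}<\infty$. \textbf{Theorem.} Let $\mathcal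 D$ be a dyadic grid on $\mathbb{R}$, $b\in\mathrm{BMO}^{\mathcal D}$, $w\in A_2$ and $f\in L^2(w)$. Then the series defining the dyadic paraproduct, $$\pi_bf=\sum_{I\in\mathcal D}\langle f\rangle_I\,\langle b,h_I\rangle\,h_I,$$ converges unconditionally in $L^2(w)$, and $$\|\pi_bf\|_{L^2(w)}\le 8\,[w]_{A_2}\,\|b\|_{\mathrm{BMO}^{\mathcal D}}\,\|f\|_{L^2(w)}.$$ -/

import Mathlib

open MeasureTheory Filter Topology
open scoped ENNReal

noncomputable section

/-- A dyadic grid on `ℝ`, organized in generations indexed by `ℤ`.  A pair `(a, b)` stands for the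
half-open interval `[a, b)`.  Each generation partitions the line, and the two halves of an interval
of generation `j` are intervals of generation `j + 1`.  (It follows that every interval of
generation `j + 1` is a half of a unique interval of generation `j`, and that two intervals of the
grid are either disjoint or nested.) -/
structure DyadicGrid where
  gen : ℤ → Set (ℝ × ℝ)
  lt_of_mem : ∀ j : ℤ, ∀ I ∈ gen j, I.1 < I.2
  partition : ∀ (j : ℤ) (x : ℝ), ∃! I : ℝ × ℝ, I ∈ gen j ∧ x ∈ Set.Ico I.1 I.2
  left_half_mem : ∀ j : ℤ, ∀ I ∈ gen j, (I.1, (I.1 + I.2) / 2) ∈ gen (j + 1)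
  right_half_mem : ∀ j : ℤ, ∀ I ∈ gen j, ((I.1 + I.2) / 2, I.2) ∈ gen (j + 1)

/-- The collection of all intervals of the grid (given by their endpoints). -/
def DyadicGrid.intervals (D : DyadicGrid) : Set (ℝ × ℝ) := ⋃ j : ℤ, D.gen j

/-- The Haar function `|I|^{-1/2} (1_{I_r} - 1_{I_l})` of the interval `I = [a, b)`, where
`I_l`, `I_r` are the left and right halves of `I`. -/
def haar (I : ℝ × ℝ) (x : ℝ) : ℝ :=
  (Real.sqrt (I.2 - I.1))⁻¹ *
    ((Set.Ico ((I.1 + I.2) / 2) I.2).indicator (fun _ => (1 : ℝ)) x -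
      (Set.Ico I.1 ((I.1 + I.2) / 2)).indicator (fun _ => (1 : ℝ)) x)

/-- The average of `f` over the interval `I = [a, b)` with respect to Lebesgue measure. -/
def avg {𝕜 : Type*} [RCLike 𝕜] (f : ℝ → 𝕜) (I : ℝ × ℝ) : 𝕜 :=
  ⨍ x in Set.Ico I.1 I.2, f x

/-- A weight: a locally integrable function that is positive almost everywhere. -/
def IsWeight (w : ℝ → ℝ) : Prop :=
  LocallyIntegrable w ∧ ∀ᵐ x, 0 < w x

/-- The measure `w dx`. -/
def weightMeasure (w : ℝ → ℝ) : Measure ℝ :=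
  volume.withDensity fun x => ENNReal.ofReal (w x)

/-- The `A₂` characteristic: the supremum over all bounded intervals of the product of the averages
of `w` and of `1 / w`, as an extended nonnegative number. -/
def a2Characteristic (w : ℝ → ℝ) : ℝ≥0∞ :=
  ⨆ (a : ℝ) (b : ℝ) (_ : a < b),
    (⨍⁻ x in Set.Ico a b, ENNReal.ofReal (w x) ∂volume) *
      (⨍⁻ x in Set.Ico a b, ENNReal.ofReal ((w x)⁻¹) ∂volume)

/-- The class `A₂`. -/
def IsA2Weight (w : ℝ → ℝ) : Prop :=
  IsWeight w ∧ a2Characteristic w < ∞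

/-- The dyadic BMO norm, defined through the `L²` mean oscillation over the intervals of the grid,
as an extended nonnegative number. -/
def bmoNorm {𝕜 : Type*} [RCLike 𝕜] (D : DyadicGrid) (b : ℝ → 𝕜) : ℝ≥0∞ :=
  ⨆ J ∈ D.intervals, (⨍⁻ x in Set.Ico J.1 J.2, ‖b x - avg b J‖ₑ ^ 2 ∂volume) ^ (1 / 2 : ℝ)

/-- The space of functions of dyadic bounded mean oscillation. -/
def MemDyadicBMO {𝕜 : Type*} [RCLike 𝕜] (D : DyadicGrid) (b : ℝ → 𝕜) : Prop :=
  LocallyIntegrable b ∧ bmoNorm D b < ∞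

/-- The Haar coefficient `b_I = ⟨b, h_I⟩`. -/
def haarCoeff {𝕜 : Type*} [RCLike 𝕜] (b : ℝ → 𝕜) (I : ℝ × ℝ) : 𝕜 :=
  ∫ x, b x * (haar I x : 𝕜)

/-- The term `⟨f⟩_I b_I h_I` of the dyadic paraproduct. -/
def paraproductTerm {𝕜 : Type*} [RCLike 𝕜] (b f : ℝ → 𝕜) (I : ℝ × ℝ) (x : ℝ) : 𝕜 :=
  avg f I * haarCoeff b I * (haar I x : 𝕜)

/-- `T` represents `π_b f = ∑_{I ∈ D} ⟨f⟩_I b_I h_I` in `L²(w)`: `T` is in `L²(w)`, and the finite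
partial sums of the series converge to `T` in `L²(w)`, unconditionally (that is, along the directed
set of all finite sets of intervals of the grid).  Such a `T` is unique up to a null set. -/
def IsParaproduct {𝕜 : Type*} [RCLike 𝕜] (D : DyadicGrid) (w : ℝ → ℝ) (b f T : ℝ → 𝕜) : Prop :=
  MemLp T 2 (weightMeasure w) ∧
    Tendsto
      (fun F : Finset D.intervals =>
        eLpNorm (fun x => T x - ∑ I ∈ F, paraproductTerm b f (I : ℝ × ℝ) x) 2 (weightMeasure w))
      atTop (𝓝 0)

end

/-! Pairing a finite partial sum `u` with itself in `L²(w)` bounds `‖u‖²` by `∑ |⟨f⟩_K b_K ⟨G,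
h_K⟩|` with `G = ū w`. It is enough to bound this form by `8 B Q ‖f‖ ‖u‖`, where `Q = [w]_{A₂}` and
`B` is slightly above the BMO norm, and then cancel one factor `‖u‖`.

The form is estimated by a Bellman induction down a dyadic tree (`formSum_le`). Let `M` and `N` be
running majorants of the averages of `|f| w` with respect to `w⁻¹ dx` and of `|u|` with respect to
`w dx`. By the `A₂` condition, `m = Q M N` dominates `⟨|f|⟩⟨|G|⟩`. Each summand is split by the
inequality between arithmetic and geometric means into a multiple of `b_K² m / B` and a multiple of
`B ⟨|f|⟩² |ΔG|² / m`. The first part is paid for by the squared oscillation of `b`, which loses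
exactly `b_K²` when `K` is halved; the second by the concavity of an explicit Bellman function for
fixed `m` (`bellman_drop`). Raising `m` to `m'` on an interval of length `L` costs at most `B L (m'
- m)` for the oscillation and the same for the Bellman function (`bellman_sub_le`). These costs
telescope to `2 B Q` times the integral of the product of the two maximal functions. The
Cauchy–Schwarz inequality and Doob's inequality, with constant `2` for each factor, give `2 · 2 · 2
= 8` (`formSum_le_sqrt`).

A finite family of intervals is covered by finitely many trees with disjoint tops, and the bounds
are added by Cauchy–Schwarz (`sum_term_le`). Finally, uniformly bounded finite partial sums force
unconditional convergence in a Hilbert space (`summable_of_norm_sum_le`), and the norm bound passes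
to the limit. -/

/-! ### Concavity inequalities in normalized variables -/

/-- Concavity of the geometric mean with an explicit deficit. Writing `α = 1 ± a` and `β = h ± b`,
the square of the left side is at most `(1 + h)² - (a - b)²`; since `1 + h ≤ 2`, its root is at most
`1 + h - (a - b)² / 4`. -/
lemma sqrt_mul_add_sqrt_mul_le {α₁ α₂ β₁ β₂ h : ℝ} (hα₁ : 0 ≤ α₁) (hα₂ : 0 ≤ α₂) (hβ₁ : 0 ≤ β₁)
    (hβ₂ : 0 ≤ β₂) (hα : α₁ + α₂ = 2) (hβ : β₁ + β₂ = 2 * h) (h1 : h ≤ 1) :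
    √(α₁ * β₁) + √(α₂ * β₂) ≤ 1 + h - ((α₁ - α₂) / 2 - (β₁ - β₂) / 2) ^ 2 / 4 := by
  have h0 : 0 ≤ h := by linarith
  set z := ((α₁ - α₂) / 2 - (β₁ - β₂) / 2) ^ 2 / 4 with hz
  have hz0 : 0 ≤ z := by positivity
  have hzle : z ≤ (1 + h) ^ 2 / 4 := by
    rw [hz]
    have : ((α₁ - α₂) / 2 - (β₁ - β₂) / 2) ^ 2 ≤ (1 + h) ^ 2 := by
      apply sq_le_sq'
      · linarith
      · linarith
    linarith
  have hnn : 0 ≤ 1 + h - z := by nlinarith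
  have hp := Real.sq_sqrt (mul_nonneg hα₁ hβ₁)
  have hq := Real.sq_sqrt (mul_nonneg hα₂ hβ₂)
  have hpq : √(α₁ * β₁) * √(α₂ * β₂) ≤ (α₁ * α₂ + β₁ * β₂) / 2 := by
    rw [← Real.sqrt_mul (mul_nonneg hα₁ hβ₁)]
    apply Real.sqrt_le_iff.mpr
    constructor
    · positivity
    · nlinarith [sq_nonneg (α₁ * α₂ - β₁ * β₂)]
  refine le_of_sq_le_sq ?_ hnn
  have e : (√(α₁ * β₁) + √(α₂ * β₂)) ^ 2 ≤ (1 + h) ^ 2 - 4 * z := by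
    have : (√(α₁ * β₁) + √(α₂ * β₂)) ^ 2
        = α₁ * β₁ + α₂ * β₂ + 2 * (√(α₁ * β₁) * √(α₂ * β₂)) := by
      rw [add_sq, hp, hq]; ring
    rw [this, hz]
    have e1 : α₂ = 2 - α₁ := by linarith
    have e2 : β₂ = 2 * h - β₁ := by linarith
    subst e1 e2
    nlinarith
  nlinarith

lemma quadratic_nonneg {α β γ : ℝ} (hα : 0 < α) (h : β ^ 2 ≤ 4 * α * γ) (d τ : ℝ) :
    0 ≤ α * d ^ 2 + β * d * τ + γ * τ ^ 2 := by
  have : 0 ≤ 4 * α * (α * d ^ 2 + β * d * τ + γ * τ ^ 2) := by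
    nlinarith [sq_nonneg (2 * α * d + β * τ), mul_nonneg (sub_nonneg.2 h) (sq_nonneg τ)]
  by_contra hc
  push Not at hc
  nlinarith [mul_pos hα (neg_pos.2 hc)]

/-- The discriminant condition of the form in `(d, τ)` met in `quadratic_form_nonneg`, divided by `1
- t²` and cleared of denominators by `t³`. -/
lemma discriminant_poly {t : ℝ} (h1 : t ≤ 1) :
    (1 - t ^ 2) * t * (16 / 25 + 44 / 35 * t) ^ 2 ≤
      4 * (3 / 140 + 4 / 25 * t + 22 / 35 * t ^ 2) * (16 / 25 + 4 / 25 * t ^ 2 - 22 / 35 * t ^ 3) := by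
  nlinarith [sq_nonneg (t ^ 2 - 7 / 20 * t - 1 / 10), sq_nonneg (t - 2 / 5)]

/-- With `x = y + d` and `σ = R τ`, where `R = 1 - t²`, completing the square in `y` leaves a binary
quadratic form in `(d, τ)` plus a nonnegative multiple of `X - R τ²`. -/
lemma quadratic_form_nonneg {t x y σ X : ℝ} (h0 : 0 < t) (h1 : t ≤ 1)
    (hσ : σ ^ 2 ≤ (1 - t ^ 2) * X) (hX : 0 ≤ X) :
    0 ≤ 13 / 20 * (x - y) ^ 2 + 4 / 25 * t * (x - y + 2 * σ / t ^ 2) ^ 2 + 4 / 5 * (X / t)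
      + 2 / 5 * ((1 - t ^ 2) * x ^ 2 + 4 * x * (σ + y * (1 - t ^ 2)))
      - 3 / 5 * (X + 2 * y * σ + y ^ 2 * (1 - t ^ 2)) := by
  set R := 1 - t ^ 2 with hR
  have hR0 : 0 ≤ R := by nlinarith
  have hXt : X ≤ X / t := by rw [le_div_iff₀ h0]; nlinarith
  rcases hR0.eq_or_lt with hR1 | hRpos
  · have hs : σ = 0 := by
      rw [← hR1] at hσ
      nlinarith
    rw [← hR1, hs]
    have : 0 ≤ 4 / 25 * t * (x - y + 2 * 0 / t ^ 2) ^ 2 := by positivity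
    nlinarith [sq_nonneg (x - y)]
  · obtain ⟨τ, rfl⟩ : ∃ τ, σ = R * τ := ⟨σ / R, by field_simp⟩
    have hXτ : R * τ ^ 2 ≤ X := by
      have : R * (R * τ ^ 2) ≤ R * X := by nlinarith
      exact le_of_mul_le_mul_left this hRpos
    obtain ⟨d, rfl⟩ : ∃ d, x = y + d := ⟨x - y, by ring⟩
    have hα : 0 < 3 / 140 + 4 / 25 * t + 22 / 35 * t ^ 2 := by positivity
    have key := quadratic_nonneg (α := 3 / 140 + 4 / 25 * t + 22 / 35 * t ^ 2)
      (β := R * (16 / 25 / t + 44 / 35))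
      (γ := R * (16 / 25 * R / t ^ 3 + 4 / 5 / t - 22 / 35)) hα (by
        have := discriminant_poly h1
        have e : R * (16 / 25 / t + 44 / 35) ^ 2 ≤ 4 * (3 / 140 + 4 / 25 * t + 22 / 35 * t ^ 2) *
            (16 / 25 * R / t ^ 3 + 4 / 5 / t - 22 / 35) := by
          have e1 : R * (16 / 25 / t + 44 / 35) ^ 2
            = ((1 - t ^ 2) * t * (16 / 25 + 44 / 35 * t) ^ 2) / t ^ 3 := by
            rw [hR]; field_simp
          have e2 : 4 * (3 / 140 + 4 / 25 * t + 22 / 35 * t ^ 2) *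
            (16 / 25 * R / t ^ 3 + 4 / 5 / t - 22 / 35) = (4 * (3 / 140 + 4 / 25 * t + 22 / 35 * t ^ 2)
              * (16 / 25 + 4 / 25 * t ^ 2 - 22 / 35 * t ^ 3)) / t ^ 3 := by
            rw [hR]; field_simp; ring
          rw [e1, e2]
          gcongr
        nlinarith [mul_le_mul_of_nonneg_left e hRpos.le]) d τ
    have hX2 : (4 / 5 / t - 3 / 5) * (R * τ ^ 2) ≤ (4 / 5 / t - 3 / 5) * X := by
      apply mul_le_mul_of_nonneg_left hXτ
      have : 4 / 5 ≤ 4 / 5 / t := by rw [le_div_iff₀ h0]; nlinarith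
      linarith
    have hsq : 0 ≤ R * (7 / 5) * (y + (6 / 7 * d + τ / 7)) ^ 2 := by positivity
    have e : 13 / 20 * (y + d - y) ^ 2 + 4 / 25 * t * (y + d - y + 2 * (R * τ) / t ^ 2) ^ 2
        + 4 / 5 * (X / t)
        + 2 / 5 * (R * (y + d) ^ 2 + 4 * (y + d) * (R * τ + y * R))
        - 3 / 5 * (X + 2 * y * (R * τ) + y ^ 2 * R)
        = ((3 / 140 + 4 / 25 * t + 22 / 35 * t ^ 2) * d ^ 2 + R * (16 / 25 / t + 44 / 35) * d * τ +
          R * (16 / 25 * R / t ^ 3 + 4 / 5 / t - 22 / 35) * τ ^ 2)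
          + R * (7 / 5) * (y + (6 / 7 * d + τ / 7)) ^ 2
          + ((4 / 5 / t - 3 / 5) * X - (4 / 5 / t - 3 / 5) * (R * τ ^ 2)) := by
      rw [hR]; field_simp; ring
    rw [e]
    linarith

/-- If `R`, `Γ`, `w` are the squared norms and the inner product of vectors `u`, `v`, this is `‖v -
y u‖²`. -/
lemma sq_sub_nonneg_of_sq_le {R Γ w : ℝ} (hR : 0 ≤ R) (hΓ : 0 ≤ Γ) (hw : w ^ 2 ≤ R * Γ) (y : ℝ) :
    0 ≤ Γ - 2 * y * w + y ^ 2 * R := by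
  have h : (2 * y * w) ^ 2 ≤ (Γ + y ^ 2 * R) ^ 2 := by
    nlinarith [sq_nonneg (Γ - y ^ 2 * R), mul_le_mul_of_nonneg_left hw (sq_nonneg y)]
  have := (abs_le.1 (abs_le_of_sq_le_sq h (by positivity))).2
  linarith

/-- Here `k` is the convexity defect of `|γ|² / g` under halving, namely `‖v - y u‖² / (1 - y²)`. At
`y = ±1` one half carries no mass; the hypotheses then force `Γ = R` and `w = ±R`, and with the
convention `a / 0 = 0` the choice `k = 0` works. -/
lemma quotient_deficit {R Γ w y : ℝ} (hR : 0 ≤ R) (hΓ : 0 ≤ Γ) (hw : w ^ 2 ≤ R * Γ)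
    (hy₁ : -1 ≤ y) (hy₂ : y ≤ 1) (h₁ : R + Γ + 2 * w ≤ (1 + y) ^ 2)
    (h₂ : R + Γ - 2 * w ≤ (1 - y) ^ 2) :
    ∃ k : ℝ, 0 ≤ k ∧ Γ - 2 * y * w + y ^ 2 * R = (1 - y ^ 2) * k ∧
      ((1 + y) - (R + Γ + 2 * w) / (1 + y)) + ((1 - y) - (R + Γ - 2 * w) / (1 - y))
        = 2 * (1 - R - k) ∧
      (((1 + y) - (R + Γ + 2 * w) / (1 + y)) - ((1 - y) - (R + Γ - 2 * w) / (1 - y))) / 2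
        = y * (1 - R) + y * k - 2 * (w - y * R) := by
  have hX := sq_sub_nonneg_of_sq_le hR hΓ hw y
  rcases eq_or_ne y 1 with rfl | hy1
  · have a1 : 2 * w = R + Γ := by nlinarith
    have a2 : Γ = R := by nlinarith [sq_nonneg (R - Γ)]
    subst a2
    obtain rfl : w = Γ := by linarith
    refine ⟨0, le_rfl, ?_, ?_, ?_⟩ <;> ring
  rcases eq_or_ne y (-1) with rfl | hy2
  · have a1 : 2 * w = -(R + Γ) := by nlinarith
    have a2 : Γ = R := by nlinarith [sq_nonneg (R - Γ)]
    subst a2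
    obtain rfl : w = -Γ := by linarith
    refine ⟨0, le_rfl, ?_, ?_, ?_⟩ <;> ring
  have p1 : 0 < 1 + y := by
    rcases hy₁.lt_or_eq with h | h
    · linarith
    · exact absurd h.symm hy2
  have p2 : 0 < 1 - y := by
    rcases hy₂.lt_or_eq with h | h
    · linarith
    · exact absurd h hy1
  have p3 : 0 < 1 - y ^ 2 := by nlinarith
  refine ⟨(Γ - 2 * y * w + y ^ 2 * R) / (1 - y ^ 2), by positivity, by field_simp, ?_, ?_⟩
  · have : 1 - y ^ 2 = (1 + y) * (1 - y) := by ring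
    rw [this]
    field_simp
    ring
  · have : 1 - y ^ 2 = (1 + y) * (1 - y) := by ring
    rw [this]
    field_simp
    ring

/-- Dividing the `η`'s by `t² = 1 - R` and putting `k = t² κ`, the deficit form of concavity with `h
= 1 - κ` supplies `D`. The required bound on `Γ` is then a form of `quadratic_form_nonneg`. -/
lemma exists_sqrt_drop {R Γ w x y k η₁ η₂ : ℝ} (hq : 0 < 1 - R) (hR : 0 ≤ R) (hk0 : 0 ≤ k)
    (hk1 : Γ - 2 * y * w + y ^ 2 * R = (1 - y ^ 2) * k)
    (hk2 : η₁ + η₂ = 2 * (1 - R - k))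
    (hk3 : (η₁ - η₂) / 2 = y * (1 - R) + y * k - 2 * (w - y * R))
    (hσ : (w - y * R) ^ 2 ≤ R * ((1 - y ^ 2) * k)) (hX0 : 0 ≤ (1 - y ^ 2) * k)
    (hx₁ : -1 ≤ x) (hx₂ : x ≤ 1) (hη₁ : 0 ≤ η₁) (hη₂ : 0 ≤ η₂) :
    ∃ D, D ≤ 2 * √(1 - R) - √((1 + x) * η₁) - √((1 - x) * η₂) ∧ 0 ≤ D ∧
      2 * Γ ≤ 26 / 5 * ((x - y) ^ 2 / 4) + 8 / 5 * D
        + 4 / 5 * (Γ + R * x ^ 2 + 4 * x * w) := by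
  obtain ⟨t, ht0, ht2⟩ : ∃ t : ℝ, 0 < t ∧ t ^ 2 = 1 - R :=
    ⟨√(1 - R), Real.sqrt_pos.2 hq, Real.sq_sqrt hq.le⟩
  have ht : √(1 - R) = t := by rw [← ht2, Real.sqrt_sq ht0.le]
  have ht1 : t ≤ 1 := by rw [← ht]; exact Real.sqrt_le_iff.2 ⟨zero_le_one, by linarith⟩
  have ht20 : 0 < t ^ 2 := by positivity
  obtain ⟨κ, hκ⟩ : ∃ κ, k = t ^ 2 * κ := ⟨k / t ^ 2, by field_simp⟩
  have hκ0 : 0 ≤ κ := by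
    have := hk0; rw [hκ] at this; exact nonneg_of_mul_nonneg_right this ht20
  have hκ1 : κ ≤ 1 := by
    have h3 : 0 ≤ t ^ 2 * (1 - κ) := by rw [mul_sub, ← hκ, ht2]; linarith
    have := nonneg_of_mul_nonneg_right h3 ht20
    linarith
  have hB := sqrt_mul_add_sqrt_mul_le (α₁ := 1 + x) (α₂ := 1 - x) (β₁ := η₁ / t ^ 2)
    (β₂ := η₂ / t ^ 2) (h := 1 - κ) (by linarith) (by linarith) (by positivity) (by positivity)
    (by ring) (by rw [← add_div, hk2, hκ, ← ht2]; field_simp) (by linarith)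
  have hsc : ∀ z η : ℝ, √(z * η) = t * √(z * (η / t ^ 2)) := by
    intro z η
    rw [show z * η = t ^ 2 * (z * (η / t ^ 2)) by field_simp, Real.sqrt_mul (by positivity),
      Real.sqrt_sq ht0.le]
  have hu : (1 + x - (1 - x)) / 2 - (η₁ / t ^ 2 - η₂ / t ^ 2) / 2
      = x - y - y * κ + 2 * (w - y * R) / t ^ 2 := by
    have : (η₁ / t ^ 2 - η₂ / t ^ 2) / 2 = ((η₁ - η₂) / 2) / t ^ 2 := by ring
    rw [this, hk3, hκ, ← ht2]; field_simp; ring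
  rw [hu] at hB
  refine ⟨t * (κ + (x - y - y * κ + 2 * (w - y * R) / t ^ 2) ^ 2 / 4), ?_, by positivity, ?_⟩
  · rw [hsc (1 + x) η₁, hsc (1 - x) η₂, ht]
    have := mul_le_mul_of_nonneg_left hB ht0.le
    linarith
  · have hR' : R = 1 - t ^ 2 := by linarith
    have hmain := quadratic_form_nonneg (t := t) (x := x) (y := y) (σ := w - y * R)
      (X := (1 - y ^ 2) * k) ht0 ht1 (by rw [← hR']; exact hσ) hX0
    rw [← hR'] at hmain
    have hXt : (1 - y ^ 2) * k / t = t * κ - t * (y ^ 2 * κ) := by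
      rw [hκ]; field_simp
    have hΓe : (1 - y ^ 2) * k = Γ - 2 * y * w + y ^ 2 * R := hk1.symm
    rw [hXt, hΓe] at hmain
    have e : x - y - y * κ + 2 * (w - y * R) / t ^ 2
        = (x - y + 2 * (w - y * R) / t ^ 2) - y * κ := by ring
    rw [e]
    generalize x - y + 2 * (w - y * R) / t ^ 2 = Z at hmain ⊢
    have hyk : t * (y ^ 2 * κ ^ 2) ≤ t * (y ^ 2 * κ) := by
      have : κ ^ 2 ≤ κ := by nlinarith
      gcongr
    -- After `κ² ≤ κ`, the excess of `8 / 5 * D` over twice the matching terms of `hmain` is at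
    -- least `2 t (Z / 5 - y κ)²`.
    have hyz : 0 ≤ t * (Z / 5 - y * κ) ^ 2 := by positivity
    linarith

/-- The relative form of `bellman_drop`: `P = f g / m`, the halves carry `f (1 ± x)` and `g (1 ±
y)`, and `N`, `Δ`, `w` are measured in units of `g²`. The first root pays when `x` and `y` differ,
the second when `γ` varies out of proportion to `g`, and the last term when `f`, `g` and `γ` vary
together. -/
lemma bellman_normalized {P R Γ w x y : ℝ} (hP₀ : 0 ≤ P) (hP₁ : P ≤ 1) (hR : 0 ≤ R) (hR₁ : R ≤ 1)
    (hΓ : 0 ≤ Γ) (hw : w ^ 2 ≤ R * Γ) (hx₁ : -1 ≤ x) (hx₂ : x ≤ 1)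
    (hy₁ : -1 ≤ y) (hy₂ : y ≤ 1) (h₁ : R + Γ + 2 * w ≤ (1 + y) ^ 2)
    (h₂ : R + Γ - 2 * w ≤ (1 - y) ^ 2) :
    2 * (P ^ 2 * Γ) +
      (26 / 5 * √(P * ((1 + x) * (1 + y)))
        + 8 / 5 * √(P * ((1 + x) * ((1 + y) - (R + Γ + 2 * w) / (1 + y))))
        - 2 / 5 * (P ^ 2 * ((1 + x) ^ 2 * (R + Γ + 2 * w)))) +
      (26 / 5 * √(P * ((1 - x) * (1 - y)))
        + 8 / 5 * √(P * ((1 - x) * ((1 - y) - (R + Γ - 2 * w) / (1 - y))))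
        - 2 / 5 * (P ^ 2 * ((1 - x) ^ 2 * (R + Γ - 2 * w))))
      ≤ 2 * (26 / 5 * √P + 8 / 5 * √(P * (1 - R)) - 2 / 5 * (P ^ 2 * R)) := by
  obtain ⟨k, hk0, hk1, hk2, hk3⟩ := quotient_deficit hR hΓ hw hy₁ hy₂ h₁ h₂
  have hη₁ : 0 ≤ (1 + y) - (R + Γ + 2 * w) / (1 + y) := by
    rcases (show 0 ≤ 1 + y by linarith).eq_or_lt with h | h
    · rw [← h]; simp
    · rw [sub_nonneg, div_le_iff₀ h]; nlinarith
  have hη₂ : 0 ≤ (1 - y) - (R + Γ - 2 * w) / (1 - y) := by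
    rcases (show 0 ≤ 1 - y by linarith).eq_or_lt with h | h
    · rw [← h]; simp
    · rw [sub_nonneg, div_le_iff₀ h]; nlinarith
  set η₁ := (1 + y) - (R + Γ + 2 * w) / (1 + y)
  set η₂ := (1 - y) - (R + Γ - 2 * w) / (1 - y)
  -- The gains from the roots scale like `√P`, all other terms like `P²`, so `P = 1` is the worst
  -- case.
  have hsP : P ^ 2 ≤ √P := by
    apply Real.le_sqrt_of_sq_le
    calc (P ^ 2) ^ 2 = P * P ^ 3 := by ring
      _ ≤ P * 1 := by gcongr; exact pow_le_one₀ hP₀ hP₁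
      _ = P := mul_one P
  simp only [Real.sqrt_mul hP₀]
  have hA := sqrt_mul_add_sqrt_mul_le (α₁ := 1 + x) (α₂ := 1 - x) (β₁ := 1 + y) (β₂ := 1 - y)
    (h := 1) (by linarith) (by linarith) (by linarith) (by linarith) (by ring) (by ring) le_rfl
  have hA' : √((1 + x) * (1 + y)) + √((1 - x) * (1 - y)) ≤ 2 - (x - y) ^ 2 / 4 := by
    refine hA.trans (le_of_eq ?_); ring
  -- it suffices to treat `P = 1`
  suffices H : ∃ D, D ≤ 2 * √(1 - R) - √((1 + x) * η₁) - √((1 - x) * η₂) ∧ 0 ≤ D ∧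
      2 * Γ ≤ 26 / 5 * ((x - y) ^ 2 / 4) + 8 / 5 * D
        + 4 / 5 * (Γ + R * x ^ 2 + 4 * x * w) by
    obtain ⟨D, hD, hD0, hD1⟩ := H
    have hΓx : 0 ≤ x ^ 2 * Γ := by positivity
    have s0 : 0 ≤ 26 / 5 * ((x - y) ^ 2 / 4) + 8 / 5 * D := by positivity
    have s1 : P ^ 2 * (26 / 5 * ((x - y) ^ 2 / 4) + 8 / 5 * D) ≤
        √P * (26 / 5 * ((x - y) ^ 2 / 4) + 8 / 5 * D) := by gcongr
    have s2 : √P * (26 / 5 * ((x - y) ^ 2 / 4) + 8 / 5 * D) ≤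
        √P * (26 / 5 * (2 - √((1 + x) * (1 + y)) - √((1 - x) * (1 - y))) +
          8 / 5 * (2 * √(1 - R) - √((1 + x) * η₁) - √((1 - x) * η₂))) := by
      gcongr
      linarith
    have s3 := mul_le_mul_of_nonneg_left hD1 (sq_nonneg P)
    have s4 : 0 ≤ P ^ 2 * (x ^ 2 * Γ) := by positivity
    nlinarith
  have hσ : (w - y * R) ^ 2 ≤ R * ((1 - y ^ 2) * k) := by
    rw [← hk1]; nlinarith
  have hX0 : 0 ≤ (1 - y ^ 2) * k := by rw [← hk1]; exact sq_sub_nonneg_of_sq_le hR hΓ hw y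
  rcases (show 0 ≤ 1 - R by linarith).eq_or_lt with hq | hq
  · have hk : k = 0 := by linarith
    have e1 : η₁ = 0 := by linarith
    have e2 : η₂ = 0 := by linarith
    refine ⟨0, by simp [e1, e2, ← hq], le_rfl, ?_⟩
    have hR1 : R = 1 := by linarith
    subst hR1 hk
    have : w = y := by nlinarith
    subst this
    nlinarith [sq_nonneg (x + w / 7)]
  · exact exists_sqrt_drop hq hR hk0 hk1 hk2 hk3 hσ hX0 hx₁ hx₂ hη₁ hη₂

/-! ### The Bellman function: concavity and dependence on the running maximum -/

/-- The Bellman function; `f` and `g` are averages of nonnegative functions, `N` is the squared norm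
of the average of a function dominated by `g`, and `m` is a running maximum of `f * g`. -/
noncomputable def bellman (f g N m : ℝ) : ℝ :=
  26 / 5 * √(m * (f * g)) + 8 / 5 * √(m * (f * (g - N / g))) - 2 / 5 * (f ^ 2 * N / m)

lemma bellman_zero_left (g N m : ℝ) : bellman 0 g N m = 0 := by simp [bellman]

lemma bellman_zero_middle (f m : ℝ) : bellman f 0 0 m = 0 := by simp [bellman]

lemma mul_sqrt_div_mul {m a : ℝ} (hm : 0 < m) (z : ℝ) : m * √(a / m * z) = √(m * (a * z)) := by
  have e : m * (a * z) = m ^ 2 * (a / m * z) := by field_simp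
  rw [e, Real.sqrt_mul (sq_nonneg m), Real.sqrt_sq hm.le]

lemma mul_sqrt_div {m a : ℝ} (hm : 0 < m) : m * √(a / m) = √(m * a) := by
  simpa using mul_sqrt_div_mul (a := a) hm 1

/-- Concavity of the Bellman function for a fixed running maximum. -/
lemma bellman_drop {m f g f₁ f₂ g₁ g₂ N Δ w : ℝ} (hm : 0 < m) (hf₁ : 0 ≤ f₁) (hf₂ : 0 ≤ f₂)
    (hg₁ : 0 ≤ g₁) (hg₂ : 0 ≤ g₂) (hf : f₁ + f₂ = 2 * f) (hg : g₁ + g₂ = 2 * g)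
    (hfg : f * g ≤ m) (hN : 0 ≤ N) (hΔ : 0 ≤ Δ) (hw : w ^ 2 ≤ N * Δ) (hNg : N ≤ g ^ 2)
    (h₁ : N + Δ + 2 * w ≤ g₁ ^ 2) (h₂ : N + Δ - 2 * w ≤ g₂ ^ 2) :
    2 * (f ^ 2 * Δ / m) + bellman f₁ g₁ (N + Δ + 2 * w) m + bellman f₂ g₂ (N + Δ - 2 * w) m
      ≤ 2 * bellman f g N m := by
  rcases (show 0 ≤ f by linarith).eq_or_lt with hf0 | hf0
  · obtain rfl : f₁ = 0 := by linarith
    obtain rfl : f₂ = 0 := by linarith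
    simp [← hf0, bellman_zero_left]
  rcases (show 0 ≤ g by linarith).eq_or_lt with hg0 | hg0
  · obtain rfl : g₁ = 0 := by linarith
    obtain rfl : g₂ = 0 := by linarith
    obtain rfl : N = 0 := by rw [← hg0] at hNg; linarith
    obtain rfl : w = 0 := by nlinarith
    obtain rfl : Δ = 0 := by linarith
    simp [← hg0, bellman_zero_middle]
  obtain ⟨x, rfl⟩ : ∃ x, f₁ = f * (1 + x) := ⟨f₁ / f - 1, by field_simp; ring⟩
  obtain ⟨y, rfl⟩ : ∃ y, g₁ = g * (1 + y) := ⟨g₁ / g - 1, by field_simp; ring⟩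
  obtain rfl : f₂ = f * (1 - x) := by linarith
  obtain rfl : g₂ = g * (1 - y) := by linarith
  obtain ⟨R, rfl⟩ : ∃ R, N = g ^ 2 * R := ⟨N / g ^ 2, by field_simp⟩
  obtain ⟨Γ, rfl⟩ : ∃ Γ, Δ = g ^ 2 * Γ := ⟨Δ / g ^ 2, by field_simp⟩
  obtain ⟨v, rfl⟩ : ∃ v, w = g ^ 2 * v := ⟨w / g ^ 2, by field_simp⟩
  have hg2 : 0 < g ^ 2 := by positivity
  have hR0 : 0 ≤ R := nonneg_of_mul_nonneg_right hN hg2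
  have hΓ0 : 0 ≤ Γ := nonneg_of_mul_nonneg_right hΔ hg2
  have hx₁ : 0 ≤ 1 + x := nonneg_of_mul_nonneg_right hf₁ hf0
  have hx₂ : 0 ≤ 1 - x := nonneg_of_mul_nonneg_right hf₂ hf0
  have hy₁ : 0 ≤ 1 + y := nonneg_of_mul_nonneg_right hg₁ hg0
  have hy₂ : 0 ≤ 1 - y := nonneg_of_mul_nonneg_right hg₂ hg0
  have hv : v ^ 2 ≤ R * Γ := by
    have : (g ^ 2) ^ 2 * v ^ 2 ≤ (g ^ 2) ^ 2 * (R * Γ) := by linarith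
    exact le_of_mul_le_mul_left this (by positivity)
  have key := bellman_normalized (P := f * g / m) (R := R) (Γ := Γ) (w := v) (x := x) (y := y)
    (by positivity) ((div_le_one hm).2 hfg) hR0
    (le_of_mul_le_mul_left (by linarith) hg2) hΓ0 hv (by linarith) (by linarith)
    (by linarith) (by linarith)
    (le_of_mul_le_mul_left (by linarith) hg2) (le_of_mul_le_mul_left (by linarith) hg2)
  have key2 := mul_le_mul_of_nonneg_left key hm.le
  have q₁ : ∀ s u : ℝ, f * s * (g * u - (g ^ 2 * R + g ^ 2 * Γ + 2 * (g ^ 2 * v)) / (g * u))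
      = f * g * (s * (u - (R + Γ + 2 * v) / u)) := by
    intro s u
    have : (g ^ 2 * R + g ^ 2 * Γ + 2 * (g ^ 2 * v)) / (g * u) = g * ((R + Γ + 2 * v) / u) := by
      rw [show g ^ 2 * R + g ^ 2 * Γ + 2 * (g ^ 2 * v) = g * (g * (R + Γ + 2 * v)) by ring,
        mul_div_mul_left _ _ hg0.ne', mul_div_assoc]
    rw [this]; ring
  have q₂ : ∀ s u : ℝ, f * s * (g * u - (g ^ 2 * R + g ^ 2 * Γ - 2 * (g ^ 2 * v)) / (g * u))
      = f * g * (s * (u - (R + Γ - 2 * v) / u)) := by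
    intro s u
    have : (g ^ 2 * R + g ^ 2 * Γ - 2 * (g ^ 2 * v)) / (g * u) = g * ((R + Γ - 2 * v) / u) := by
      rw [show g ^ 2 * R + g ^ 2 * Γ - 2 * (g ^ 2 * v) = g * (g * (R + Γ - 2 * v)) by ring,
        mul_div_mul_left _ _ hg0.ne', mul_div_assoc]
    rw [this]; ring
  have q₃ : f * (g - g ^ 2 * R / g) = f * g * (1 - R) := by field_simp
  have q₄ : ∀ s u : ℝ, f * s * (g * u) = f * g * (s * u) := by intros; ring
  simp only [bellman, q₁, q₂, q₃, q₄]
  rw [← mul_sqrt_div (a := f * g) hm]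
  simp only [← mul_sqrt_div_mul hm]
  have r : ∀ z : ℝ, m * ((f * g / m) ^ 2 * z) = f ^ 2 * g ^ 2 * z / m := by
    intro z; field_simp
  have r₀ := r Γ
  have r₁ := r ((1 + x) ^ 2 * (R + Γ + 2 * v))
  have r₂ := r ((1 - x) ^ 2 * (R + Γ - 2 * v))
  have r₃ := r R
  have e₀ : f ^ 2 * (g ^ 2 * Γ) / m = f ^ 2 * g ^ 2 * Γ / m := by ring
  have e₁ : (f * (1 + x)) ^ 2 * (g ^ 2 * R + g ^ 2 * Γ + 2 * (g ^ 2 * v)) / m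
      = f ^ 2 * g ^ 2 * ((1 + x) ^ 2 * (R + Γ + 2 * v)) / m := by ring
  have e₂ : (f * (1 - x)) ^ 2 * (g ^ 2 * R + g ^ 2 * Γ - 2 * (g ^ 2 * v)) / m
      = f ^ 2 * g ^ 2 * ((1 - x) ^ 2 * (R + Γ - 2 * v)) / m := by ring
  have e₃ : f ^ 2 * (g ^ 2 * R) / m = f ^ 2 * g ^ 2 * R / m := by ring
  rw [e₀, e₁, e₂, e₃, ← r₀, ← r₁, ← r₂, ← r₃]
  linarith

/-- Overshooting supplies `P ≤ (m + m') / 2`, far better than `P ≤ m'`. This suffices while `√m' ≤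
53/20 √m`; beyond that `P ≤ 4 m` takes over. -/
lemma sqrt_le_sqrt_add_sqrt {P m m' : ℝ} (hm : 0 < m) (hmm : m ≤ m')
    (h2 : 2 * P ≤ m + m') (h4 : P ≤ 4 * m) : √P ≤ 11 / 20 * (√m + √m') := by
  have ha : √m ^ 2 = m := Real.sq_sqrt hm.le
  have hb : √m' ^ 2 = m' := Real.sq_sqrt (hm.le.trans hmm)
  have hab : √m ≤ √m' := Real.sqrt_le_sqrt hmm
  have ha0 : 0 < √m := Real.sqrt_pos.2 hm
  generalize √m = a at *
  generalize √m' = b at *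
  apply Real.sqrt_le_iff.2 ⟨by linarith, ?_⟩
  rcases le_total b (53 / 20 * a) with h | h
  · nlinarith [mul_nonneg (sub_nonneg.2 h) (sub_nonneg.2 hab)]
  · nlinarith

/-- The two bounds on `P` coincide at `m' = 7 m`, which is where `16 / 7` is attained. -/
lemma sq_le_mul_of_le {P m m' : ℝ} (hP : 0 ≤ P) (hm : 0 < m) (hmm : m ≤ m')
    (h2 : 2 * P ≤ m + m') (h4 : P ≤ 4 * m) : P ^ 2 ≤ 16 / 7 * (m * m') := by
  rcases le_total m' (7 * m) with h | h
  · nlinarith [mul_nonneg (sub_nonneg.2 h) (show 0 ≤ 7 * m' - m by linarith)]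
  · nlinarith

/-- Dependence of the Bellman function on the running maximum. -/
lemma bellman_sub_le {f g N m m' : ℝ} (hf : 0 ≤ f) (hg : 0 ≤ g) (hN : 0 ≤ N) (hNg : N ≤ g ^ 2)
    (hm : 0 < m) (hmm : m ≤ m') (h2 : 2 * (f * g) ≤ m + m') (h4 : f * g ≤ 4 * m) :
    bellman f g N m' - 4 * m' ≤ bellman f g N m - 4 * m := by
  have hm' : 0 < m' := hm.trans_le hmm
  rcases hg.eq_or_lt with hg0 | hg0
  · obtain rfl : N = 0 := by rw [← hg0] at hNg; linarith
    rw [← hg0, bellman_zero_middle, bellman_zero_middle]; linarith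
  obtain ⟨R, rfl⟩ : ∃ R, N = g ^ 2 * R := ⟨N / g ^ 2, by field_simp⟩
  have hg2 : 0 < g ^ 2 := by positivity
  have hR0 : 0 ≤ R := nonneg_of_mul_nonneg_right hN hg2
  have hR1 : R ≤ 1 := le_of_mul_le_mul_left (by linarith) hg2
  have hP : 0 ≤ f * g := by positivity
  have q₃ : f * (g - g ^ 2 * R / g) = f * g * (1 - R) := by field_simp
  have q₅ : f ^ 2 * (g ^ 2 * R) = (f * g) ^ 2 * R := by ring
  simp only [bellman, q₃, q₅, Real.sqrt_mul hm.le, Real.sqrt_mul hm'.le, Real.sqrt_mul hP]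
  have hs := sqrt_le_sqrt_add_sqrt hm hmm h2 h4
  have hq := sq_le_mul_of_le hP hm hmm h2 h4
  have ht2 : √(1 - R) ^ 2 = 1 - R := Real.sq_sqrt (by linarith)
  have ht0 : 0 ≤ √(1 - R) := Real.sqrt_nonneg _
  have ha : √m ^ 2 = m := Real.sq_sqrt hm.le
  have hb : √m' ^ 2 = m' := Real.sq_sqrt hm'.le
  have hab : 0 ≤ √m' - √m := sub_nonneg.2 (Real.sqrt_le_sqrt hmm)
  have hd : (f * g) ^ 2 * R / m - (f * g) ^ 2 * R / m' ≤ 16 / 7 * R * (m' - m) := by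
    have e : (f * g) ^ 2 * R / m - (f * g) ^ 2 * R / m'
        = (f * g) ^ 2 / (m * m') * (R * (m' - m)) := by field_simp
    rw [e]
    have h3 : (f * g) ^ 2 / (m * m') ≤ 16 / 7 := by rw [div_le_iff₀ (by positivity)]; exact hq
    have h5 : 0 ≤ R * (m' - m) := mul_nonneg hR0 (by linarith)
    nlinarith
  have hs1 : (26 / 5 + 8 / 5 * √(1 - R)) * (√(f * g) * (√m' - √m)) ≤
      (26 / 5 + 8 / 5 * √(1 - R)) * (11 / 20 * (m' - m)) := by
    have : √(f * g) * (√m' - √m) ≤ 11 / 20 * (m' - m) := by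
      calc √(f * g) * (√m' - √m) ≤ 11 / 20 * (√m + √m') * (√m' - √m) := by gcongr
        _ = 11 / 20 * (m' - m) := by rw [← ha, ← hb]; ring_nf; simp [ha, hb]
    gcongr
  have hfin : 0 ≤ (4 - ((26 / 5 + 8 / 5 * √(1 - R)) * (11 / 20) + 2 / 5 * (16 / 7 * R))) *
      (m' - m) := by
    apply mul_nonneg _ (by linarith)
    -- With `t = √(1 - R)` the subtracted bracket is a concave quadratic in `t`; its maximum, near
    -- `t = 12/25`, lies just below `4`.
    nlinarith [sq_nonneg (√(1 - R) - 12 / 25)]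
  linarith

/-! ### The bilinear estimate on a binary tree -/

/-- The quantities entering the bilinear estimate, as additive functions on the vertices of an
infinite binary tree: `L` is the length, `F` and `A` the integrals of `|f|` and `|G|`, `γ` the
integral of `G`, `S` and `W` the integrals of `w⁻¹` and `w`, `X` and `Y` the integrals of `|f|² w`
and `|G|² w⁻¹`, `c` the modulus of the Haar coefficient of `b`, and `V` the integral of the squared
oscillation of `b`. -/
structure WeightedTree (𝕜 ι : Type*) [RCLike 𝕜] where
  left : ι → ι
  right : ι → ι
  (L F S W X Y A c V : ι → ℝ)
  γ : ι → 𝕜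
  (B Q : ℝ)
  L_pos : ∀ I, 0 < L I
  L_left : ∀ I, L (left I) = L I / 2
  L_right : ∀ I, L (right I) = L I / 2
  F_add : ∀ I, F (left I) + F (right I) = F I
  S_add : ∀ I, S (left I) + S (right I) = S I
  W_add : ∀ I, W (left I) + W (right I) = W I
  X_add : ∀ I, X (left I) + X (right I) = X I
  Y_add : ∀ I, Y (left I) + Y (right I) = Y I
  A_add : ∀ I, A (left I) + A (right I) = A I
  γ_add : ∀ I, γ (left I) + γ (right I) = γ I
  V_add : ∀ I, V (left I) + V (right I) + c I ^ 2 = V I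
  F_nonneg : ∀ I, 0 ≤ F I
  A_nonneg : ∀ I, 0 ≤ A I
  S_pos : ∀ I, 0 < S I
  W_pos : ∀ I, 0 < W I
  γ_le : ∀ I, ‖γ I‖ ≤ A I
  F_sq : ∀ I, F I ^ 2 ≤ X I * S I
  A_sq : ∀ I, A I ^ 2 ≤ Y I * W I
  L_sq : ∀ I, L I ^ 2 ≤ S I * W I
  SW_le : ∀ I, S I * W I ≤ Q * L I ^ 2
  V_nonneg : ∀ I, 0 ≤ V I
  V_le : ∀ I, V I ≤ B ^ 2 * L I

/-- The update of the running maximum in Doob's inequality, with overshooting: a value `φ` above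
the current maximum `M` reflects it to `2 φ - M`. -/
noncomputable def reflectedMax (M φ : ℝ) : ℝ := max M (2 * φ - M)

lemma le_reflectedMax_left (M φ : ℝ) : M ≤ reflectedMax M φ := le_max_left _ _

lemma two_mul_le_reflectedMax (M φ : ℝ) : 2 * φ ≤ M + reflectedMax M φ := by
  have := le_max_right M (2 * φ - M)
  rw [reflectedMax]; linarith

lemma le_reflectedMax_right (M φ : ℝ) : φ ≤ reflectedMax M φ := by
  have := le_reflectedMax_left M φ
  have := two_mul_le_reflectedMax M φ
  linarith

/-- With `φ = F / S` the expression is `2 S ((M - φ)² - φ²)`, which is invariant under the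
reflection `M ↦ 2 φ - M`. Overshooting is therefore free in Doob's inequality. -/
lemma reflectedMax_energy {S F : ℝ} (hS : 0 < S) (M : ℝ) :
    2 * S * reflectedMax M (F / S) ^ 2 - 4 * reflectedMax M (F / S) * F
      ≤ 2 * S * M ^ 2 - 4 * M * F := by
  rw [reflectedMax]
  rcases max_cases M (2 * (F / S) - M) with ⟨h, -⟩ | ⟨h, -⟩
  · rw [h]
  · rw [h]
    apply le_of_eq
    field_simp
    ring

lemma sqrt_mul_sqrt_add_le {a b c d : ℝ} (ha : 0 ≤ a) (hb : 0 ≤ b) (hc : 0 ≤ c) (hd : 0 ≤ d) :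
    √a * √b + √c * √d ≤ √(a + c) * √(b + d) := by
  rw [← Real.sqrt_mul (add_nonneg ha hc)]
  apply Real.le_sqrt_of_sq_le
  have h1 := Real.sq_sqrt ha
  have h2 := Real.sq_sqrt hb
  have h3 := Real.sq_sqrt hc
  have h4 := Real.sq_sqrt hd
  nlinarith [sq_nonneg (√a * √d - √c * √b)]

namespace WeightedTree

variable {𝕜 ι : Type*} [RCLike 𝕜] (T : WeightedTree 𝕜 ι)

/-- The sum of `|⟨f⟩_K b_K ⟨G, h_K⟩|` over the vertices `K` below `I` of relative depth less than
`n`. -/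
noncomputable def formSum : ℕ → ι → ℝ
  | 0, _ => 0
  | n + 1, I => T.c I * (T.F I / T.L I) * (‖T.γ (T.right I) - T.γ (T.left I)‖ / √(T.L I))
      + formSum n (T.left I) + formSum n (T.right I)

/-- The integral of the product of the two reflected maximal functions of depth `n`. -/
noncomputable def maxIntegral : ℕ → ι → ℝ → ℝ → ℝ
  | 0, I, M, N => T.L I * (M * N)
  | n + 1, I, M, N =>
    maxIntegral n (T.left I) (reflectedMax M (T.F (T.left I) / T.S (T.left I)))
      (reflectedMax N (T.A (T.left I) / T.W (T.left I))) +
    maxIntegral n (T.right I) (reflectedMax M (T.F (T.right I) / T.S (T.right I)))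
      (reflectedMax N (T.A (T.right I) / T.W (T.right I)))

/-- The squared norm of the reflected maximal function of depth `n` of `F / S`, with respect
to `S`. -/
noncomputable def maxEnergy (S F : ι → ℝ) : ℕ → ι → ℝ → ℝ
  | 0, I, M => S I * M ^ 2
  | n + 1, I, M =>
    maxEnergy S F n (T.left I) (reflectedMax M (F (T.left I) / S (T.left I))) +
    maxEnergy S F n (T.right I) (reflectedMax M (F (T.right I) / S (T.right I)))

lemma maxEnergy_nonneg {S F : ι → ℝ} (hS : ∀ I, 0 < S I) (n : ℕ) (I : ι) (M : ℝ) :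
    0 ≤ T.maxEnergy S F n I M := by
  induction n generalizing I M with
  | zero => exact mul_nonneg (hS I).le (sq_nonneg M)
  | succ n ih => exact add_nonneg (ih _ _) (ih _ _)

/-- Doob's inequality. -/
lemma maxEnergy_le {S F X : ι → ℝ} (hS : ∀ I, 0 < S I) (hF : ∀ I, F I ^ 2 ≤ X I * S I)
    (hSa : ∀ I, S (T.left I) + S (T.right I) = S I) (hFa : ∀ I, F (T.left I) + F (T.right I) = F I)
    (hXa : ∀ I, X (T.left I) + X (T.right I) = X I) (n : ℕ) (I : ι) (M : ℝ) :
    T.maxEnergy S F n I M ≤ 4 * X I + (2 * S I * M ^ 2 - 4 * M * F I) := by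
  induction n generalizing I M with
  | zero =>
    -- The product equals `(S M - 2 F)² + 4 (X S - F²)`.
    have h : 0 ≤ S I * (4 * X I + (2 * S I * M ^ 2 - 4 * M * F I) - S I * M ^ 2) := by
      nlinarith [hF I, sq_nonneg (S I * M - 2 * F I)]
    have := nonneg_of_mul_nonneg_right h (hS I)
    simp only [maxEnergy]; linarith
  | succ n ih =>
    have h1 := ih (T.left I) (reflectedMax M (F (T.left I) / S (T.left I)))
    have h2 := ih (T.right I) (reflectedMax M (F (T.right I) / S (T.right I)))
    have h3 := reflectedMax_energy (F := F (T.left I)) (hS (T.left I)) M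
    have h4 := reflectedMax_energy (F := F (T.right I)) (hS (T.right I)) M
    rw [← hSa I, ← hFa I, ← hXa I]
    simp only [maxEnergy]
    linarith

/-- Cauchy–Schwarz for `dx = w^{-1/2} w^{1/2} dx`. At the leaves it is `L² ≤ S W`; the halves are
combined by Cauchy–Schwarz in the plane. -/
lemma maxIntegral_le (n : ℕ) (I : ι) {M N : ℝ} (hM : 0 ≤ M) (hN : 0 ≤ N) :
    T.maxIntegral n I M N ≤ √(T.maxEnergy T.S T.F n I M) * √(T.maxEnergy T.W T.A n I N) := by
  induction n generalizing I M N with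
  | zero =>
    simp only [maxIntegral, maxEnergy]
    have hS := T.S_pos I
    have hW := T.W_pos I
    rw [← Real.sqrt_mul (by positivity)]
    apply Real.le_sqrt_of_sq_le
    have := mul_le_mul_of_nonneg_left (T.L_sq I) (sq_nonneg (M * N))
    nlinarith
  | succ n ih =>
    refine (add_le_add (ih _ (hM.trans (le_reflectedMax_left _ _))
      (hN.trans (le_reflectedMax_left _ _))) (ih _ (hM.trans (le_reflectedMax_left _ _))
      (hN.trans (le_reflectedMax_left _ _)))).trans ?_
    exact sqrt_mul_sqrt_add_le (T.maxEnergy_nonneg T.S_pos _ _ _) (T.maxEnergy_nonneg T.W_pos _ _ _)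
      (T.maxEnergy_nonneg T.S_pos _ _ _) (T.maxEnergy_nonneg T.W_pos _ _ _)

/-- The Bellman function at a vertex. -/
noncomputable def bellmanAt (I : ι) (m : ℝ) : ℝ :=
  bellman (T.F I / T.L I) (T.A I / T.L I) ((‖T.γ I‖ / T.L I) ^ 2) m

/-- The `A₂` condition enters here: passing from Lebesgue averages to weighted ones costs exactly
the factor `S W / L² ≤ Q`. -/
lemma avg_mul_avg_le {I : ι} {M N : ℝ} (hM : T.F I / T.S I ≤ M) (hN : T.A I / T.W I ≤ N) :
    (T.F I / T.L I) * (T.A I / T.L I) ≤ T.Q * (M * N) := by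
  have hL := T.L_pos I
  have hS := T.S_pos I
  have hW := T.W_pos I
  have hF := T.F_nonneg I
  have hA := T.A_nonneg I
  have hφ : 0 ≤ T.F I / T.S I := by positivity
  have hg : 0 ≤ T.A I / T.W I := by positivity
  have e : (T.F I / T.L I) * (T.A I / T.L I) =
      (T.S I * T.W I / T.L I ^ 2) * ((T.F I / T.S I) * (T.A I / T.W I)) := by field_simp
  have hQ : T.S I * T.W I / T.L I ^ 2 ≤ T.Q := by
    rw [div_le_iff₀ (by positivity)]; exact T.SW_le I
  rw [e]
  have hQ0 : 0 ≤ T.Q := le_trans (by positivity) hQ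
  gcongr
  exact hφ.trans hM

lemma normAvg_le (I : ι) : (‖T.γ I‖ / T.L I) ^ 2 ≤ (T.A I / T.L I) ^ 2 := by
  have hL := T.L_pos I
  have := T.γ_le I
  gcongr

/-- The effect of the increase of the running maximum at a vertex `J`. -/
lemma change_max {J : ι} {M N M' N' : ℝ} (hB : 0 < T.B) (hMM : M ≤ M') (hNN : N ≤ N')
    (hm : 0 < T.Q * (M * N)) (hM : 0 ≤ M) (hN : 0 ≤ N) (hM' : 2 * (T.F J / T.S J) ≤ M + M')
    (hN' : 2 * (T.A J / T.W J) ≤ N + N') (hQ : 0 ≤ T.Q)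
    (h4 : (T.F J / T.L J) * (T.A J / T.L J) ≤ 4 * (T.Q * (M * N))) :
    T.V J / T.B * (T.Q * (M' * N')) + T.B / 4 * T.L J * T.bellmanAt J (T.Q * (M' * N'))
        - 2 * T.B * T.L J * (T.Q * (M' * N'))
      ≤ T.V J / T.B * (T.Q * (M * N)) + T.B / 4 * T.L J * T.bellmanAt J (T.Q * (M * N))
        - 2 * T.B * T.L J * (T.Q * (M * N)) := by
  have hL := T.L_pos J
  have hS := T.S_pos J
  have hW := T.W_pos J
  have hF := T.F_nonneg J
  have hA := T.A_nonneg J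
  have hmm : T.Q * (M * N) ≤ T.Q * (M' * N') := by gcongr; exact hM.trans hMM
  have h2 : 2 * ((T.F J / T.L J) * (T.A J / T.L J)) ≤ T.Q * (M * N) + T.Q * (M' * N') := by
    have h := T.avg_mul_avg_le (I := J) (M := (M + M') / 2) (N := (N + N') / 2)
      (by linarith) (by linarith)
    -- Chebyshev: since both factors increase, the product of the midpoints is at most the midpoint
    -- of the products.
    have h' : 0 ≤ T.Q * ((M' - M) * (N' - N)) :=
      mul_nonneg hQ (mul_nonneg (sub_nonneg.2 hMM) (sub_nonneg.2 hNN))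
    nlinarith
  have hb := bellman_sub_le (f := T.F J / T.L J) (g := T.A J / T.L J)
    (N := (‖T.γ J‖ / T.L J) ^ 2) (by positivity) (by positivity) (by positivity) (T.normAvg_le J)
    hm hmm h2 h4
  have hV : T.V J / T.B ≤ T.B * T.L J := by
    rw [div_le_iff₀ hB]; have := T.V_le J; linarith
  have h5 := mul_le_mul_of_nonneg_right hV (sub_nonneg.2 hmm)
  have h6 := mul_le_mul_of_nonneg_left hb (show 0 ≤ T.B / 4 * T.L J by positivity)
  simp only [bellmanAt]
  linarith

lemma bellmanAt_drop (I : ι) {m : ℝ} (hm : 0 < m) (h : (T.F I / T.L I) * (T.A I / T.L I) ≤ m) :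
    2 * ((T.F I / T.L I) ^ 2 * (‖T.γ (T.right I) - T.γ (T.left I)‖ / T.L I) ^ 2 / m)
      + T.bellmanAt (T.left I) m + T.bellmanAt (T.right I) m ≤ 2 * T.bellmanAt I m := by
  have hL := T.L_pos I
  have hl := T.L_left I
  have hr := T.L_right I
  set u : 𝕜 := T.γ I
  set v : 𝕜 := T.γ (T.left I) - T.γ (T.right I) with hv
  have e₁ : ‖T.γ (T.left I)‖ / T.L (T.left I) = ‖u + v‖ / T.L I := by
    have : u + v = 2 * T.γ (T.left I) := by
      rw [hv, show u = T.γ (T.left I) + T.γ (T.right I) from (T.γ_add I).symm]; ring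
    rw [this, norm_mul, RCLike.norm_ofNat, hl]; field_simp
  have e₂ : ‖T.γ (T.right I)‖ / T.L (T.right I) = ‖u - v‖ / T.L I := by
    have : u - v = 2 * T.γ (T.right I) := by
      rw [hv, show u = T.γ (T.left I) + T.γ (T.right I) from (T.γ_add I).symm]; ring
    rw [this, norm_mul, RCLike.norm_ofNat, hr]; field_simp
  have e₃ : ‖T.γ (T.right I) - T.γ (T.left I)‖ = ‖v‖ := by rw [hv, norm_sub_rev]
  set w := RCLike.re (inner 𝕜 u v) with hw
  have n₁ : (‖u + v‖ / T.L I) ^ 2 = (‖u‖ / T.L I) ^ 2 + (‖v‖ / T.L I) ^ 2 + 2 * (w / T.L I ^ 2) := by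
    rw [div_pow, norm_add_sq (𝕜 := 𝕜) u v]; ring
  have n₂ : (‖u - v‖ / T.L I) ^ 2 = (‖u‖ / T.L I) ^ 2 + (‖v‖ / T.L I) ^ 2 - 2 * (w / T.L I ^ 2) := by
    rw [div_pow, norm_sub_sq (𝕜 := 𝕜) u v]; ring
  have hwle : w ^ 2 ≤ ‖u‖ ^ 2 * ‖v‖ ^ 2 := by
    rw [← mul_pow]
    exact sq_le_sq' (by
      have := (abs_le.1 ((RCLike.abs_re_le_norm _).trans (norm_inner_le_norm (𝕜 := 𝕜) u v))).1
      linarith) (by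
      have := (abs_le.1 ((RCLike.abs_re_le_norm _).trans (norm_inner_le_norm (𝕜 := 𝕜) u v))).2
      linarith)
  have hFl := T.F_nonneg (T.left I)
  have hFr := T.F_nonneg (T.right I)
  have hAl := T.A_nonneg (T.left I)
  have hAr := T.A_nonneg (T.right I)
  have hLl := T.L_pos (T.left I)
  have hLr := T.L_pos (T.right I)
  have key := bellman_drop (m := m) (f := T.F I / T.L I) (g := T.A I / T.L I)
    (f₁ := T.F (T.left I) / T.L (T.left I)) (f₂ := T.F (T.right I) / T.L (T.right I))
    (g₁ := T.A (T.left I) / T.L (T.left I)) (g₂ := T.A (T.right I) / T.L (T.right I))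
    (N := (‖u‖ / T.L I) ^ 2) (Δ := (‖v‖ / T.L I) ^ 2) (w := w / T.L I ^ 2) hm
    (by positivity) (by positivity) (by positivity) (by positivity)
    (by rw [hl, hr, ← T.F_add I]; field_simp) (by rw [hl, hr, ← T.A_add I]; field_simp) h
    (by positivity) (by positivity)
    (by
      have : (w / T.L I ^ 2) ^ 2 = w ^ 2 / T.L I ^ 4 := by rw [div_pow]; ring
      rw [this, div_pow, div_pow, div_mul_div_comm]
      have e : T.L I ^ 2 * T.L I ^ 2 = T.L I ^ 4 := by ring
      rw [e]; gcongr)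
    (T.normAvg_le I)
    (by rw [← n₁, ← e₁]; exact T.normAvg_le _)
    (by rw [← n₂, ← e₂]; exact T.normAvg_le _)
  rw [← n₁, ← n₂, ← e₁, ← e₂] at key
  rw [e₃]
  exact key

lemma child_avg_le {F L : ι → ℝ} (hL : ∀ I, 0 < L I) (hF : ∀ I, 0 ≤ F I)
    {I J K : ι} (hLJ : L J = L I / 2) (hadd : F J + F K = F I) :
    F J / L J ≤ 2 * (F I / L I) := by
  have := hL I
  have := hF K
  rw [hLJ, div_div_eq_mul_div, ← mul_div_assoc, mul_comm 2 (F I)]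
  gcongr
  linarith

/-- The induction invariant. With `M`, `N` frozen, halving an interval releases enough oscillation
and Bellman value to pay for its summand; updating `M`, `N` on a half is paid for by the term `-2 B
L m`, whose final value is recorded by `maxIntegral`. -/
theorem formSum_le (hB : 0 < T.B) (hQ : 0 < T.Q) (n : ℕ) (I : ι) {M N : ℝ} (hM0 : 0 < M)
    (hN0 : 0 < N) (hM : T.F I / T.S I ≤ M) (hN : T.A I / T.W I ≤ N) :
    T.formSum n I ≤ T.V I / T.B * (T.Q * (M * N))
      + T.B / 4 * T.L I * T.bellmanAt I (T.Q * (M * N))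
      + 2 * T.B * (T.Q * T.maxIntegral n I M N) - 2 * T.B * T.L I * (T.Q * (M * N)) := by
  induction n generalizing I M N with
  | zero =>
    have hL := T.L_pos I
    have hV := T.V_nonneg I
    have hm : 0 < T.Q * (M * N) := by positivity
    have h1 : 0 ≤ T.V I / T.B * (T.Q * (M * N)) := by positivity
    have h2 : 0 ≤ T.bellmanAt I (T.Q * (M * N)) := by
      have hP := T.avg_mul_avg_le hM hN
      have hF := T.F_nonneg I
      have hA := T.A_nonneg I
      have hN' := T.normAvg_le I
      rw [bellmanAt, bellman]
      set m := T.Q * (M * N)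
      set f := T.F I / T.L I
      set g := T.A I / T.L I
      have hf : 0 ≤ f := by positivity
      have hg : 0 ≤ g := by positivity
      have h3 : f ^ 2 * (‖T.γ I‖ / T.L I) ^ 2 / m ≤ √(m * (f * g)) := by
        rw [div_le_iff₀ hm]
        have h4 : f * g ≤ √(m * (f * g)) := by
          apply Real.le_sqrt_of_sq_le
          nlinarith [mul_nonneg hf hg]
        calc f ^ 2 * (‖T.γ I‖ / T.L I) ^ 2 ≤ f ^ 2 * g ^ 2 := by gcongr
          _ = (f * g) * (f * g) := by ring
          _ ≤ √(m * (f * g)) * m := by gcongr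
      have h5 := Real.sqrt_nonneg (m * (f * g))
      have h6 := Real.sqrt_nonneg (m * (f * (g - (‖T.γ I‖ / T.L I) ^ 2 / g)))
      linarith
    have h3 : 0 ≤ T.B / 4 * T.L I * T.bellmanAt I (T.Q * (M * N)) := by positivity
    simp only [formSum, maxIntegral]
    linarith
  | succ n ih =>
    have hL := T.L_pos I
    have hm : 0 < T.Q * (M * N) := by positivity
    have hP := T.avg_mul_avg_le hM hN
    have hFI := T.F_nonneg I
    have hAI := T.A_nonneg I
    have step : ∀ J K : ι, T.L J = T.L I / 2 → T.F J + T.F K = T.F I → T.A J + T.A K = T.A I →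
        T.formSum n J ≤ T.V J / T.B * (T.Q * (M * N))
          + T.B / 4 * T.L J * T.bellmanAt J (T.Q * (M * N))
          + 2 * T.B * (T.Q * T.maxIntegral n J (reflectedMax M (T.F J / T.S J))
            (reflectedMax N (T.A J / T.W J))) - 2 * T.B * T.L J * (T.Q * (M * N)) := by
      intro J K hLJ hFJ hAJ
      have hc := T.change_max (J := J) hB (le_reflectedMax_left M (T.F J / T.S J))
        (le_reflectedMax_left N (T.A J / T.W J)) hm hM0.le hN0.le (two_mul_le_reflectedMax _ _)
        -- Each of the two averages at most doubles from an interval to its half; this is the source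
        -- of the factor `4`.
        (two_mul_le_reflectedMax _ _) hQ.le (by
          have h1 := child_avg_le T.L_pos T.F_nonneg hLJ hFJ
          have h2 := child_avg_le T.L_pos T.A_nonneg hLJ hAJ
          have hA := T.A_nonneg J
          have hLJ0 := T.L_pos J
          calc T.F J / T.L J * (T.A J / T.L J)
              ≤ (2 * (T.F I / T.L I)) * (2 * (T.A I / T.L I)) := by gcongr
            _ = 4 * ((T.F I / T.L I) * (T.A I / T.L I)) := by ring
            _ ≤ _ := by gcongr)
      have hi := ih J (M := reflectedMax M (T.F J / T.S J)) (N := reflectedMax N (T.A J / T.W J))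
        (hM0.trans_le (le_reflectedMax_left _ _)) (hN0.trans_le (le_reflectedMax_left _ _))
        (le_reflectedMax_right _ _) (le_reflectedMax_right _ _)
      linarith
    have s₁ := step (T.left I) (T.right I) (T.L_left I) (T.F_add I) (T.A_add I)
    have s₂ := step (T.right I) (T.left I) (T.L_right I) (by rw [add_comm]; exact T.F_add I)
      (by rw [add_comm]; exact T.A_add I)
    have hdrop := T.bellmanAt_drop I hm hP
    rw [T.L_left] at s₁
    rw [T.L_right] at s₂
    have hV := T.V_add I
    simp only [formSum, maxIntegral]
    set m := T.Q * (M * N)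
    set f := T.F I / T.L I
    set δ := ‖T.γ (T.right I) - T.γ (T.left I)‖
    -- Arithmetic–geometric mean inequality, balanced by `m / B`.
    have hterm : T.c I * f * (δ / √(T.L I)) ≤
        T.c I ^ 2 / T.B * m + T.B / 4 * T.L I * (f ^ 2 * (δ / T.L I) ^ 2 / m) := by
      have e : T.B / 4 * T.L I * (f ^ 2 * (δ / T.L I) ^ 2 / m)
          = (f * (δ / √(T.L I))) ^ 2 * T.B / (4 * m) := by
        rw [mul_pow, div_pow δ, div_pow δ, Real.sq_sqrt hL.le]; field_simp
      rw [e]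
      set z := f * (δ / √(T.L I))
      have : T.c I ^ 2 / T.B * m + z ^ 2 * T.B / (4 * m) - T.c I * z
          = (2 * T.c I * m - z * T.B) ^ 2 / (4 * m * T.B) := by field_simp; ring
      have h0 : 0 ≤ (2 * T.c I * m - z * T.B) ^ 2 / (4 * m * T.B) := by positivity
      rw [mul_assoc]
      linarith
    -- `B / 8 * L` is the weight `B / 4` times the length of a half.
    have h7 := mul_le_mul_of_nonneg_left hdrop (show 0 ≤ T.B / 8 * T.L I by positivity)
    have h8 : T.V I / T.B * m =
        T.V (T.left I) / T.B * m + T.V (T.right I) / T.B * m + T.c I ^ 2 / T.B * m := by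
      rw [← hV]; ring
    rw [h8]
    linarith

lemma formSum_eq_zero_of_F {n : ℕ} {I : ι} (h : T.F I = 0) : T.formSum n I = 0 := by
  induction n generalizing I with
  | zero => rfl
  | succ n ih =>
    have h1 := T.F_nonneg (T.left I)
    have h2 := T.F_nonneg (T.right I)
    have h3 := T.F_add I
    rw [formSum, ih (by linarith), ih (by linarith), h]; simp

lemma formSum_eq_zero_of_A {n : ℕ} {I : ι} (h : T.A I = 0) : T.formSum n I = 0 := by
  induction n generalizing I with
  | zero => rfl
  | succ n ih =>
    have h1 := T.A_nonneg (T.left I)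
    have h2 := T.A_nonneg (T.right I)
    have h3 := T.A_add I
    have hl : T.A (T.left I) = 0 := by linarith
    have hr : T.A (T.right I) = 0 := by linarith
    have gl : T.γ (T.left I) = 0 := norm_le_zero_iff.1 (hl ▸ T.γ_le (T.left I))
    have gr : T.γ (T.right I) = 0 := norm_le_zero_iff.1 (hr ▸ T.γ_le (T.right I))
    rw [formSum, ih hl, ih hr, gl, gr]; simp

/-- The bilinear estimate on a tree. -/
theorem formSum_le_sqrt (hB : 0 < T.B) (n : ℕ) (I : ι) :
    T.formSum n I ≤ 8 * T.B * T.Q * (√(T.X I) * √(T.Y I)) := by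
  have hL := T.L_pos I
  have hS := T.S_pos I
  have hW := T.W_pos I
  have hQ : 0 < T.Q := by
    have h : 0 < T.Q * T.L I ^ 2 := lt_of_lt_of_le (by positivity) (T.SW_le I)
    exact pos_of_mul_pos_left h (by positivity)
  rcases (T.F_nonneg I).eq_or_lt with hF | hF
  · rw [T.formSum_eq_zero_of_F hF.symm]; positivity
  rcases (T.A_nonneg I).eq_or_lt with hA | hA
  · rw [T.formSum_eq_zero_of_A hA.symm]; positivity
  set φ := T.F I / T.S I with hφ
  set g := T.A I / T.W I with hg
  have hφ0 : 0 < φ := by positivity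
  have hg0 : 0 < g := by positivity
  -- Starting at `2 φ`, the reflection of `0` in `φ`, keeps the majorant positive and makes `2 S M²
  -- - 4 M F` vanish, so Doob's inequality has no initial term; likewise for `2 g`.
  have h := T.formSum_le hB hQ n I (M := 2 * φ) (N := 2 * g) (by positivity) (by positivity)
    (by linarith) (by linarith)
  have hE := T.maxIntegral_le n I (M := 2 * φ) (N := 2 * g) (by positivity) (by positivity)
  have h1 : T.maxEnergy T.S T.F n I (2 * φ) ≤ 4 * T.X I := by
    refine (T.maxEnergy_le T.S_pos T.F_sq T.S_add T.F_add T.X_add n I (2 * φ)).trans (le_of_eq ?_)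
    rw [hφ]; field_simp; ring
  have h2 : T.maxEnergy T.W T.A n I (2 * g) ≤ 4 * T.Y I := by
    refine (T.maxEnergy_le T.W_pos T.A_sq T.W_add T.A_add T.Y_add n I (2 * g)).trans (le_of_eq ?_)
    rw [hg]; field_simp; ring
  have h3 : T.maxIntegral n I (2 * φ) (2 * g) ≤ 4 * (√(T.X I) * √(T.Y I)) := by
    refine hE.trans ((mul_le_mul (Real.sqrt_le_sqrt h1) (Real.sqrt_le_sqrt h2)
      (Real.sqrt_nonneg _) (Real.sqrt_nonneg _)).trans (le_of_eq ?_))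
    rw [Real.sqrt_mul (by norm_num), Real.sqrt_mul (by norm_num),
      show √(4 : ℝ) = 2 by rw [show (4 : ℝ) = 2 ^ 2 by norm_num]; simp]
    ring
  have hm : 0 < T.Q * (2 * φ * (2 * g)) := by positivity
  have hP : (T.F I / T.L I) * (T.A I / T.L I) ≤ T.Q * (2 * φ * (2 * g)) / 4 := by
    refine (T.avg_mul_avg_le (I := I) le_rfl le_rfl).trans (le_of_eq ?_)
    ring
  -- Here `⟨|f|⟩⟨|G|⟩ ≤ m / 4`, so both roots are at most `m / 2` and the value is at most `17/5 m`.
  -- The initial oscillation and Bellman terms are then absorbed by `-2 B L m`.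
  have hb : T.bellmanAt I (T.Q * (2 * φ * (2 * g))) ≤ 4 * (T.Q * (2 * φ * (2 * g))) := by
    rw [bellmanAt, bellman]
    set m := T.Q * (2 * φ * (2 * g))
    have hfL : 0 < T.F I / T.L I := by positivity
    have hgL : 0 < T.A I / T.L I := by positivity
    have b1 : √(m * (T.F I / T.L I * (T.A I / T.L I))) ≤ m / 2 := by
      apply Real.sqrt_le_iff.2 ⟨by positivity, ?_⟩
      nlinarith
    have b2 : √(m * (T.F I / T.L I * (T.A I / T.L I - (‖T.γ I‖ / T.L I) ^ 2 / (T.A I / T.L I))))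
        ≤ m / 2 := by
      refine le_trans (Real.sqrt_le_sqrt ?_) b1
      gcongr
      have : 0 ≤ (‖T.γ I‖ / T.L I) ^ 2 / (T.A I / T.L I) := by positivity
      linarith
    have b3 : 0 ≤ (T.F I / T.L I) ^ 2 * (‖T.γ I‖ / T.L I) ^ 2 / m := by positivity
    linarith
  have hV : T.V I / T.B ≤ T.B * T.L I := by
    rw [div_le_iff₀ hB]; have := T.V_le I; linarith
  have h5 := mul_le_mul_of_nonneg_right hV hm.le
  have h6 := mul_le_mul_of_nonneg_left hb (show 0 ≤ T.B / 4 * T.L I by positivity)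
  have h7 := mul_le_mul_of_nonneg_left h3 (show 0 ≤ 2 * T.B * T.Q by positivity)
  linarith

end WeightedTree

/-! ### Cauchy–Schwarz and integrability for `A₂` weights -/

lemma sq_integral_le {α : Type*} [MeasurableSpace α] {μ : Measure α} {p x s : α → ℝ}
    (hp : AEStronglyMeasurable p μ) (hx : Integrable x μ) (hs : Integrable s μ)
    (hx0 : ∀ᵐ a ∂μ, 0 ≤ x a) (hs0 : ∀ᵐ a ∂μ, 0 ≤ s a)
    (h : ∀ᵐ a ∂μ, p a ^ 2 ≤ x a * s a) :
    Integrable p μ ∧ (∫ a, p a ∂μ) ^ 2 ≤ (∫ a, x a ∂μ) * ∫ a, s a ∂μ := by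
  have key : ∀ (l : ℝ), ∀ᵐ a ∂μ, |2 * l * p a| ≤ l * l * x a + s a := by
    intro l
    filter_upwards [hx0, hs0, h] with a h1 h2 h3
    apply abs_le_of_sq_le_sq _ (add_nonneg (mul_nonneg (mul_self_nonneg l) h1) h2)
    nlinarith [sq_nonneg (l * l * x a - s a), mul_le_mul_of_nonneg_left h3 (sq_nonneg l)]
  have hint : Integrable p μ := by
    refine (hx.add hs).mono' hp ?_
    filter_upwards [key 1, hx0, hs0] with a h1 h2 h3
    have h4 : |p a| ≤ |2 * 1 * p a| := by
      rw [abs_mul]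
      have := abs_nonneg (p a)
      norm_num
      linarith
    simp only [Pi.add_apply, Real.norm_eq_abs]
    linarith
  refine ⟨hint, ?_⟩
  have hd : discrim (∫ a, x a ∂μ) (-2 * ∫ a, p a ∂μ) (∫ a, s a ∂μ) ≤ 0 := by
    apply discrim_le_zero
    intro l
    have h1 : ∫ a, 2 * l * p a ∂μ ≤ ∫ a, (l * l * x a + s a) ∂μ := by
      apply integral_mono_ae (hint.const_mul _) ((hx.const_mul _).add hs)
      filter_upwards [key l] with a ha
      exact (le_abs_self _).trans ha
    rw [integral_add (hx.const_mul _) hs, integral_const_mul, integral_const_mul] at h1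
    linarith
  rw [discrim] at hd
  linarith

section weight

variable {w : ℝ → ℝ}

lemma IsWeight.aemeasurable (hw : IsWeight w) : AEMeasurable w volume :=
  hw.1.aestronglyMeasurable.aemeasurable

lemma MeasureTheory.LocallyIntegrable.integrableOn_Ico {E : Type*} [NormedAddCommGroup E]
    {h : ℝ → E} (hh : LocallyIntegrable h) (a b : ℝ) :
    IntegrableOn h (Set.Ico a b) :=
  (hh.integrableOn_isCompact isCompact_Icc).mono_set Set.Ico_subset_Icc_self

lemma IsWeight.absolutelyContinuous (hw : IsWeight w) :
    (volume : Measure ℝ) ≪ weightMeasure w := by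
  apply withDensity_absolutelyContinuous' hw.aemeasurable.ennreal_ofReal
  filter_upwards [hw.2] with x hx
  simpa using hx

lemma IsWeight.integral_weightMeasure {E : Type*} [NormedAddCommGroup E] [NormedSpace ℝ E]
    (hw : IsWeight w) (g : ℝ → E) : ∫ x, g x ∂(weightMeasure w) = ∫ x, w x • g x := by
  rw [weightMeasure, integral_withDensity_eq_integral_toReal_smul₀ hw.aemeasurable.ennreal_ofReal
    (by simp)]
  apply integral_congr_ae
  filter_upwards [hw.2] with x hx
  rw [ENNReal.toReal_ofReal hx.le]

lemma IsWeight.integrable_weightMeasure {E : Type*} [NormedAddCommGroup E] [NormedSpace ℝ E]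
    (hw : IsWeight w) (g : ℝ → E) :
    Integrable g (weightMeasure w) ↔ Integrable (fun x => w x • g x) := by
  rw [weightMeasure, integrable_withDensity_iff_integrable_smul₀' hw.aemeasurable.ennreal_ofReal
    (by simp)]
  apply integrable_congr
  filter_upwards [hw.2] with x hx
  rw [ENNReal.toReal_ofReal hx.le]

variable {E : Type*} [NormedAddCommGroup E]

lemma IsWeight.aestronglyMeasurable_of_memLp (hw : IsWeight w) {h : ℝ → E}
    (hh : MemLp h 2 (weightMeasure w)) : AEStronglyMeasurable h volume :=
  hh.1.mono_ac hw.absolutelyContinuous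

lemma IsWeight.integrable_sq_mul (hw : IsWeight w) {h : ℝ → E}
    (hh : MemLp h 2 (weightMeasure w)) : Integrable (fun x => ‖h x‖ ^ 2 * w x) := by
  have := (hw.integrable_weightMeasure _).1 ((memLp_two_iff_integrable_sq_norm hh.1).1 hh)
  simpa [mul_comm] using this

lemma IsWeight.eLpNorm_eq (hw : IsWeight w) {h : ℝ → E} (hh : MemLp h 2 (weightMeasure w)) :
    eLpNorm h 2 (weightMeasure w) = ENNReal.ofReal √(∫ x, ‖h x‖ ^ 2 * w x) := by
  rw [hh.eLpNorm_eq_integral_rpow_norm (by norm_num) (by norm_num), hw.integral_weightMeasure,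
    Real.sqrt_eq_rpow]
  simp [mul_comm]

lemma setIntegral_Ico_pos {a b : ℝ} (hab : a < b) {g : ℝ → ℝ}
    (hg : IntegrableOn g (Set.Ico a b)) (hpos : ∀ᵐ x, 0 < g x) :
    0 < ∫ x in Set.Ico a b, g x := by
  rw [integral_pos_iff_support_of_nonneg_ae (by
    filter_upwards [ae_restrict_of_ae hpos] with x hx using hx.le) hg]
  have h1 : (volume.restrict (Set.Ico a b)) (Function.support g)ᶜ = 0 := by
    have : ∀ᵐ x ∂(volume.restrict (Set.Ico a b)), x ∈ Function.support g := by
      filter_upwards [ae_restrict_of_ae hpos] with x hx using hx.ne'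
    exact this
  rw [pos_iff_ne_zero]
  intro h0
  have h2 := measure_union_le (μ := volume.restrict (Set.Ico a b)) (Function.support g)
    (Function.support g)ᶜ
  rw [Set.union_compl_self, h0, h1, Measure.restrict_apply_univ, Real.volume_Ico] at h2
  simp at h2
  linarith

/-- Since `∫ w > 0`, an infinite integral of `w⁻¹` over one interval would already make the
characteristic infinite. -/
lemma IsA2Weight.integrableOn_inv (hw : IsA2Weight w) {a b : ℝ} (hab : a < b) :
    IntegrableOn (fun x => (w x)⁻¹) (Set.Ico a b) ∧
      (∫ x in Set.Ico a b, (w x)⁻¹) * (∫ x in Set.Ico a b, w x)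
        ≤ (a2Characteristic w).toReal * (b - a) ^ 2 := by
  have hab' : 0 < b - a := sub_pos.2 hab
  have hle : (⨍⁻ x in Set.Ico a b, ENNReal.ofReal (w x) ∂volume) *
      (⨍⁻ x in Set.Ico a b, ENNReal.ofReal ((w x)⁻¹) ∂volume) ≤ a2Characteristic w :=
    le_iSup_of_le a (le_iSup_of_le b (le_iSup_of_le hab le_rfl))
  have hW := hw.1.1.integrableOn_Ico a b
  have hWpos := setIntegral_Ico_pos hab hW hw.1.2
  have hw0 : 0 ≤ᵐ[volume.restrict (Set.Ico a b)] w := by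
    filter_upwards [ae_restrict_of_ae hw.1.2] with x hx using hx.le
  have hs0 : 0 ≤ᵐ[volume.restrict (Set.Ico a b)] fun x => (w x)⁻¹ := by
    filter_upwards [ae_restrict_of_ae hw.1.2] with x hx using (inv_pos.2 hx).le
  rw [setLAverage_eq, setLAverage_eq, Real.volume_Ico,
    ← ofReal_integral_eq_lintegral_ofReal hW hw0] at hle
  have hfin : ∫⁻ x in Set.Ico a b, ENNReal.ofReal ((w x)⁻¹) < ∞ := by
    by_contra hc
    rw [not_lt_top_iff.1 hc, ENNReal.top_div_of_ne_top ENNReal.ofReal_ne_top,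
      ENNReal.mul_top] at hle
    · exact absurd hw.2 (not_lt.2 hle)
    · rw [← ENNReal.ofReal_div_of_pos hab']
      simpa using div_pos hWpos hab'
  have hS : IntegrableOn (fun x => (w x)⁻¹) (Set.Ico a b) :=
    ⟨hw.1.aemeasurable.inv.aestronglyMeasurable.restrict, (hasFiniteIntegral_iff_ofReal hs0).2 hfin⟩
  refine ⟨hS, ?_⟩
  rw [← ofReal_integral_eq_lintegral_ofReal hS hs0, ← ENNReal.ofReal_div_of_pos hab',
    ← ENNReal.ofReal_div_of_pos hab', ← ENNReal.ofReal_mul (by positivity)] at hle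
  have := ENNReal.toReal_mono hw.2.ne hle
  have hSpos := integral_nonneg_of_ae hs0
  rw [ENNReal.toReal_ofReal (by positivity), div_mul_div_comm, div_le_iff₀ (by positivity)] at this
  linarith

end weight

/-! ### Halves of intervals and Haar coefficients -/

/-- The left half of an interval. -/
noncomputable def leftHalf (I : ℝ × ℝ) : ℝ × ℝ := (I.1, (I.1 + I.2) / 2)

/-- The right half of an interval. -/
noncomputable def rightHalf (I : ℝ × ℝ) : ℝ × ℝ := ((I.1 + I.2) / 2, I.2)

lemma Ico_leftHalf_union {I : ℝ × ℝ} (hI : I.1 < I.2) :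
    Set.Ico (leftHalf I).1 (leftHalf I).2 ∪ Set.Ico (rightHalf I).1 (rightHalf I).2
      = Set.Ico I.1 I.2 :=
  Set.Ico_union_Ico_eq_Ico (by simp only [leftHalf]; linarith)
    (by simp only [leftHalf, rightHalf]; linarith)

lemma disjoint_halves (I : ℝ × ℝ) :
    Disjoint (Set.Ico (leftHalf I).1 (leftHalf I).2) (Set.Ico (rightHalf I).1 (rightHalf I).2) := by
  rw [Set.disjoint_left]
  intro x hx hx'
  exact absurd hx.2 (not_lt.2 hx'.1)

section halves

variable {E : Type*} [NormedAddCommGroup E] {I : ℝ × ℝ} {g : ℝ → E}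

lemma integrableOn_leftHalf (hI : I.1 < I.2) (hg : IntegrableOn g (Set.Ico I.1 I.2)) :
    IntegrableOn g (Set.Ico (leftHalf I).1 (leftHalf I).2) :=
  hg.mono_set (Ico_leftHalf_union hI ▸ Set.subset_union_left)

lemma integrableOn_rightHalf (hI : I.1 < I.2) (hg : IntegrableOn g (Set.Ico I.1 I.2)) :
    IntegrableOn g (Set.Ico (rightHalf I).1 (rightHalf I).2) :=
  hg.mono_set (Ico_leftHalf_union hI ▸ Set.subset_union_right)

lemma integral_halves [NormedSpace ℝ E] (hI : I.1 < I.2) (hg : IntegrableOn g (Set.Ico I.1 I.2)) :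
    (∫ x in Set.Ico (leftHalf I).1 (leftHalf I).2, g x) +
      ∫ x in Set.Ico (rightHalf I).1 (rightHalf I).2, g x = ∫ x in Set.Ico I.1 I.2, g x := by
  rw [← setIntegral_union (disjoint_halves I) measurableSet_Ico (integrableOn_leftHalf hI hg)
    (integrableOn_rightHalf hI hg), Ico_leftHalf_union hI]

end halves

lemma integral_mul_haar {𝕜 : Type*} [RCLike 𝕜] {I : ℝ × ℝ} (hI : I.1 < I.2) {g : ℝ → 𝕜}
    (hg : IntegrableOn g (Set.Ico I.1 I.2)) :
    ∫ x, g x * (haar I x : 𝕜) = ((√(I.2 - I.1))⁻¹ : ℝ) *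
      ((∫ x in Set.Ico (rightHalf I).1 (rightHalf I).2, g x) -
        ∫ x in Set.Ico (leftHalf I).1 (leftHalf I).2, g x) := by
  have e : (fun x => g x * (haar I x : 𝕜)) = fun x => ((√(I.2 - I.1))⁻¹ : ℝ) *
      ((Set.Ico (rightHalf I).1 (rightHalf I).2).indicator g x -
        (Set.Ico (leftHalf I).1 (leftHalf I).2).indicator g x) := by
    ext x
    simp only [haar, leftHalf, rightHalf, Set.indicator_apply]
    split_ifs <;> push_cast <;> ring
  rw [e, integral_const_mul, integral_sub, integral_indicator measurableSet_Ico,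
    integral_indicator measurableSet_Ico]
  · exact (integrable_indicator_iff measurableSet_Ico).2 (integrableOn_rightHalf hI hg)
  · exact (integrable_indicator_iff measurableSet_Ico).2 (integrableOn_leftHalf hI hg)

lemma integrable_mul_haar {𝕜 : Type*} [RCLike 𝕜] {I : ℝ × ℝ} (hI : I.1 < I.2) {g : ℝ → 𝕜}
    (hg : IntegrableOn g (Set.Ico I.1 I.2)) : Integrable fun x => g x * (haar I x : 𝕜) := by
  have e : (fun x => g x * (haar I x : 𝕜)) = fun x => ((√(I.2 - I.1))⁻¹ : ℝ) *
      ((Set.Ico (rightHalf I).1 (rightHalf I).2).indicator g x -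
        (Set.Ico (leftHalf I).1 (leftHalf I).2).indicator g x) := by
    ext x
    simp only [haar, leftHalf, rightHalf, Set.indicator_apply]
    split_ifs <;> push_cast <;> ring
  rw [e]
  exact (((integrable_indicator_iff measurableSet_Ico).2 (integrableOn_rightHalf hI hg)).sub
    ((integrable_indicator_iff measurableSet_Ico).2 (integrableOn_leftHalf hI hg))).const_mul _

lemma avg_eq {𝕜 : Type*} [RCLike 𝕜] {I : ℝ × ℝ} (hI : I.1 < I.2) (g : ℝ → 𝕜) :
    avg g I = (((I.2 - I.1)⁻¹ : ℝ) : 𝕜) * ∫ x in Set.Ico I.1 I.2, g x := by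
  rw [avg, setAverage_eq, Real.volume_real_Ico_of_le hI.le, RCLike.real_smul_eq_coe_mul]

/-! ### Dyadic BMO and squared oscillation -/

section bmo

variable {𝕜 : Type*} [RCLike 𝕜] {D : DyadicGrid} {b : ℝ → 𝕜}

lemma DyadicGrid.lt_of_mem_intervals (D : DyadicGrid) {I : ℝ × ℝ} (hI : I ∈ D.intervals) :
    I.1 < I.2 := by
  obtain ⟨j, hj⟩ := Set.mem_iUnion.1 hI
  exact D.lt_of_mem j I hj

lemma DyadicGrid.leftHalf_mem (D : DyadicGrid) {I : ℝ × ℝ} (hI : I ∈ D.intervals) :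
    leftHalf I ∈ D.intervals := by
  obtain ⟨j, hj⟩ := Set.mem_iUnion.1 hI
  exact Set.mem_iUnion.2 ⟨j + 1, D.left_half_mem j I hj⟩

lemma DyadicGrid.rightHalf_mem (D : DyadicGrid) {I : ℝ × ℝ} (hI : I ∈ D.intervals) :
    rightHalf I ∈ D.intervals := by
  obtain ⟨j, hj⟩ := Set.mem_iUnion.1 hI
  exact Set.mem_iUnion.2 ⟨j + 1, D.right_half_mem j I hj⟩

/-- The integral of the squared oscillation of `b` over `I`. -/
noncomputable def sqOscillation (b : ℝ → 𝕜) (I : ℝ × ℝ) : ℝ :=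
  ∫ x in Set.Ico I.1 I.2, ‖b x - avg b I‖ ^ 2

lemma sqOscillation_nonneg (b : ℝ → 𝕜) (I : ℝ × ℝ) : 0 ≤ sqOscillation b I :=
  integral_nonneg fun _ => by positivity

lemma MemDyadicBMO.lintegral_le (hb : MemDyadicBMO D b) {I : ℝ × ℝ} (hI : I ∈ D.intervals) :
    ∫⁻ x in Set.Ico I.1 I.2, ‖b x - avg b I‖ₑ ^ 2
      ≤ ENNReal.ofReal ((bmoNorm D b).toReal ^ 2 * (I.2 - I.1)) := by
  have hL : 0 < I.2 - I.1 := sub_pos.2 (D.lt_of_mem_intervals hI)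
  have h : (⨍⁻ x in Set.Ico I.1 I.2, ‖b x - avg b I‖ₑ ^ 2 ∂volume) ^ (1 / 2 : ℝ) ≤ bmoNorm D b :=
    le_iSup₂_of_le I hI le_rfl
  have h2 := ENNReal.rpow_le_rpow h (show (0 : ℝ) ≤ 2 by norm_num)
  rw [← ENNReal.rpow_mul, setLAverage_eq, Real.volume_Ico] at h2
  norm_num at h2
  rw [ENNReal.div_le_iff (by simpa using hL) ENNReal.ofReal_ne_top] at h2
  rw [ENNReal.ofReal_mul (by positivity), ENNReal.ofReal_pow ENNReal.toReal_nonneg,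
    ENNReal.ofReal_toReal hb.2.ne]
  exact h2

lemma MemDyadicBMO.memLp (hb : MemDyadicBMO D b) {I : ℝ × ℝ} (hI : I ∈ D.intervals) :
    MemLp (fun x => b x - avg b I) 2 (volume.restrict (Set.Ico I.1 I.2)) := by
  refine ⟨(hb.1.aestronglyMeasurable.sub aestronglyMeasurable_const).restrict, ?_⟩
  rw [eLpNorm_lt_top_iff_lintegral_rpow_enorm_lt_top (by norm_num) (by norm_num)]
  have := (hb.lintegral_le hI).trans_lt ENNReal.ofReal_lt_top
  simpa using this

lemma MemDyadicBMO.sqOscillation_le (hb : MemDyadicBMO D b) {I : ℝ × ℝ} (hI : I ∈ D.intervals) :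
    sqOscillation b I ≤ (bmoNorm D b).toReal ^ 2 * (I.2 - I.1) := by
  have hL : 0 < I.2 - I.1 := sub_pos.2 (D.lt_of_mem_intervals hI)
  have h1 : Integrable (fun x => ‖b x - avg b I‖ ^ 2) (volume.restrict (Set.Ico I.1 I.2)) :=
    (memLp_two_iff_integrable_sq_norm (hb.memLp hI).1).1 (hb.memLp hI)
  have h2 := hb.lintegral_le hI
  have h3 := ofReal_integral_eq_lintegral_ofReal h1 (Eventually.of_forall fun _ => by positivity)
  have h4 : ∀ x, ENNReal.ofReal (‖b x - avg b I‖ ^ 2) = ‖b x - avg b I‖ₑ ^ 2 := fun x => by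
    rw [ENNReal.ofReal_pow (norm_nonneg _), ofReal_norm]
  simp only [h4] at h3
  rw [← h3, ENNReal.ofReal_le_ofReal_iff (by positivity)] at h2
  exact h2

lemma MemDyadicBMO.integrable_sq (hb : MemDyadicBMO D b) {I : ℝ × ℝ} (hI : I ∈ D.intervals) :
    IntegrableOn (fun x => ‖b x‖ ^ 2) (Set.Ico I.1 I.2) := by
  have h1 : MemLp (fun x => (b x - avg b I) + avg b I) 2 (volume.restrict (Set.Ico I.1 I.2)) :=
    (hb.memLp hI).add (memLp_const _)
  simp only [sub_add_cancel] at h1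
  exact (memLp_two_iff_integrable_sq_norm h1.1).1 h1

lemma MemDyadicBMO.sqOscillation_eq (hb : MemDyadicBMO D b) {I : ℝ × ℝ} (hI : I ∈ D.intervals) :
    sqOscillation b I = (∫ x in Set.Ico I.1 I.2, ‖b x‖ ^ 2) -
      ‖∫ x in Set.Ico I.1 I.2, b x‖ ^ 2 / (I.2 - I.1) := by
  have hI' := D.lt_of_mem_intervals hI
  have hL : 0 < I.2 - I.1 := sub_pos.2 hI'
  have hbi := hb.1.integrableOn_Ico I.1 I.2
  have e : ∀ x, ‖b x - avg b I‖ ^ 2 = ‖b x‖ ^ 2 -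
      2 * RCLike.re (starRingEnd 𝕜 (avg b I) * b x) + ‖avg b I‖ ^ 2 := by
    intro x
    rw [norm_sub_sq (𝕜 := 𝕜), inner_re_symm, RCLike.inner_apply, mul_comm (b x)]
  have hi : Integrable (fun x => RCLike.re (starRingEnd 𝕜 (avg b I) * b x))
      (volume.restrict (Set.Ico I.1 I.2)) := (hbi.const_mul _).re
  have hsub : Integrable (fun x => ‖b x‖ ^ 2 - 2 * RCLike.re (starRingEnd 𝕜 (avg b I) * b x))
      (volume.restrict (Set.Ico I.1 I.2)) := Integrable.sub (hb.integrable_sq hI) (hi.const_mul 2)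
  simp only [sqOscillation, e]
  rw [integral_add hsub (integrable_const _),
    integral_sub (hb.integrable_sq hI) (hi.const_mul 2), integral_const_mul, integral_re
      (hbi.const_mul _), integral_const_mul, integral_const, avg_eq hI']
  simp only [map_mul, RCLike.conj_ofReal, measureReal_restrict_apply_univ,
    Real.volume_real_Ico_of_le hI'.le, smul_eq_mul, norm_mul, RCLike.norm_ofReal]
  rw [mul_assoc, RCLike.conj_mul, abs_of_pos (inv_pos.2 hL), ← RCLike.ofReal_pow,
    ← RCLike.ofReal_mul, RCLike.ofReal_re]
  field_simp
  ring

lemma haarCoeff_eq (hb : LocallyIntegrable b) {I : ℝ × ℝ} (hI : I.1 < I.2) :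
    haarCoeff b I = ((√(I.2 - I.1))⁻¹ : ℝ) *
      ((∫ x in Set.Ico (rightHalf I).1 (rightHalf I).2, b x) -
        ∫ x in Set.Ico (leftHalf I).1 (leftHalf I).2, b x) :=
  integral_mul_haar hI (hb.integrableOn_Ico _ _)

/-- By the parallelogram law, the variance lost when the mean over `I` is replaced by the means over
its halves is exactly the squared Haar coefficient. -/
lemma MemDyadicBMO.sqOscillation_halves (hb : MemDyadicBMO D b) {I : ℝ × ℝ} (hI : I ∈ D.intervals) :
    sqOscillation b (leftHalf I) + sqOscillation b (rightHalf I) + ‖haarCoeff b I‖ ^ 2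
      = sqOscillation b I := by
  have hI' := D.lt_of_mem_intervals hI
  have hL : 0 < I.2 - I.1 := sub_pos.2 hI'
  rw [hb.sqOscillation_eq hI, hb.sqOscillation_eq (D.leftHalf_mem hI),
    hb.sqOscillation_eq (D.rightHalf_mem hI), haarCoeff_eq hb.1 hI', norm_mul, RCLike.norm_ofReal,
    abs_of_nonneg (by positivity), ← integral_halves hI' (hb.integrable_sq hI),
    ← integral_halves hI' (hb.1.integrableOn_Ico I.1 I.2)]
  generalize (∫ x in Set.Ico (leftHalf I).1 (leftHalf I).2, b x) = u
  generalize (∫ x in Set.Ico (rightHalf I).1 (rightHalf I).2, b x) = v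
  have hp := parallelogram_law_with_norm 𝕜 u v
  have e1 : (leftHalf I).2 - (leftHalf I).1 = (I.2 - I.1) / 2 := by simp only [leftHalf]; ring
  have e2 : (rightHalf I).2 - (rightHalf I).1 = (I.2 - I.1) / 2 := by simp only [rightHalf]; ring
  rw [e1, e2, mul_pow, inv_pow, Real.sq_sqrt hL.le, norm_sub_rev v u]
  have : ‖u - v‖ ^ 2 = 2 * (‖u‖ ^ 2 + ‖v‖ ^ 2) - ‖u + v‖ ^ 2 := by linarith
  rw [this]
  field_simp
  ring

end bmo

/-! ### The tree attached to `b`, `w`, `f` and a test function -/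

section testing

variable {𝕜 : Type*} [RCLike 𝕜] {D : DyadicGrid} {w : ℝ → ℝ} {b f u : ℝ → 𝕜}

lemma IsA2Weight.integrableOn_norm (hw : IsA2Weight w) (hf : MemLp f 2 (weightMeasure w))
    {s t : ℝ} (hst : s < t) :
    IntegrableOn (fun x => ‖f x‖) (Set.Ico s t) ∧
      (∫ x in Set.Ico s t, ‖f x‖) ^ 2
        ≤ (∫ x in Set.Ico s t, ‖f x‖ ^ 2 * w x) * ∫ x in Set.Ico s t, (w x)⁻¹ := by
  have hpos := ae_restrict_of_ae (s := Set.Ico s t) hw.1.2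
  refine sq_integral_le (hw.1.aestronglyMeasurable_of_memLp hf).norm.restrict
    (hw.1.integrable_sq_mul hf).integrableOn (hw.integrableOn_inv hst).1 ?_ ?_ ?_
  · filter_upwards [hpos] with x hx using by positivity
  · filter_upwards [hpos] with x hx using by positivity
  · filter_upwards [hpos] with x hx
    rw [mul_assoc, mul_inv_cancel₀ hx.ne', mul_one]

lemma IsWeight.integrableOn_norm_mul (hw : IsWeight w) (hu : MemLp u 2 (weightMeasure w))
    (s t : ℝ) :
    IntegrableOn (fun x => ‖u x‖ * w x) (Set.Ico s t) ∧
      (∫ x in Set.Ico s t, ‖u x‖ * w x) ^ 2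
        ≤ (∫ x in Set.Ico s t, ‖u x‖ ^ 2 * w x) * ∫ x in Set.Ico s t, w x := by
  have hpos := ae_restrict_of_ae (s := Set.Ico s t) hw.2
  refine sq_integral_le ((hw.aestronglyMeasurable_of_memLp hu).norm.mul
      hw.1.aestronglyMeasurable).restrict
    (hw.integrable_sq_mul hu).integrableOn (hw.1.integrableOn_Ico s t) ?_ ?_ ?_
  · filter_upwards [hpos] with x hx using by positivity
  · filter_upwards [hpos] with x hx using hx.le
  · filter_upwards [hpos] with x hx
    exact le_of_eq (by ring)

lemma IsWeight.integrableOn_conj_mul (hw : IsWeight w) (hu : MemLp u 2 (weightMeasure w))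
    (s t : ℝ) : IntegrableOn (fun x => starRingEnd 𝕜 (u x) * (w x : 𝕜)) (Set.Ico s t) := by
  refine (hw.integrableOn_norm_mul hu s t).1.mono' ?_ ?_
  · exact ((RCLike.continuous_conj.comp_aestronglyMeasurable
      (hw.aestronglyMeasurable_of_memLp hu)).mul
      (RCLike.continuous_ofReal.comp_aestronglyMeasurable hw.1.aestronglyMeasurable)).restrict
  · filter_upwards [ae_restrict_of_ae (s := Set.Ico s t) hw.2] with x hx
    rw [norm_mul, RCLike.norm_conj, RCLike.norm_ofReal, abs_of_pos hx]

lemma IsA2Weight.sq_le (hw : IsA2Weight w) {s t : ℝ} (hst : s < t) :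
    (t - s) ^ 2 ≤ (∫ x in Set.Ico s t, (w x)⁻¹) * ∫ x in Set.Ico s t, w x := by
  have hpos := ae_restrict_of_ae (s := Set.Ico s t) hw.1.2
  have h := (sq_integral_le (p := fun _ => (1 : ℝ)) (μ := volume.restrict (Set.Ico s t))
    aestronglyMeasurable_const (hw.integrableOn_inv hst).1 (hw.1.1.integrableOn_Ico s t)
    (by filter_upwards [hpos] with x hx using by positivity)
    (by filter_upwards [hpos] with x hx using hx.le)
    (by filter_upwards [hpos] with x hx using by rw [inv_mul_cancel₀ hx.ne']; norm_num)).2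
  simpa [hst.le] using h

/-- The integrals over dyadic intervals that control the form `⟨π_b f, u⟩` in `L²(w)`. -/
noncomputable def paraproductTree (hb : MemDyadicBMO D b) (hw : IsA2Weight w)
    (hf : MemLp f 2 (weightMeasure w)) (hu : MemLp u 2 (weightMeasure w)) {B : ℝ}
    (hB : (bmoNorm D b).toReal ≤ B) : WeightedTree 𝕜 D.intervals where
  left I := ⟨leftHalf I, D.leftHalf_mem I.2⟩
  right I := ⟨rightHalf I, D.rightHalf_mem I.2⟩
  L I := I.1.2 - I.1.1
  F I := ∫ x in Set.Ico I.1.1 I.1.2, ‖f x‖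
  S I := ∫ x in Set.Ico I.1.1 I.1.2, (w x)⁻¹
  W I := ∫ x in Set.Ico I.1.1 I.1.2, w x
  X I := ∫ x in Set.Ico I.1.1 I.1.2, ‖f x‖ ^ 2 * w x
  Y I := ∫ x in Set.Ico I.1.1 I.1.2, ‖u x‖ ^ 2 * w x
  A I := ∫ x in Set.Ico I.1.1 I.1.2, ‖u x‖ * w x
  c I := ‖haarCoeff b I‖
  V I := sqOscillation b I
  γ I := ∫ x in Set.Ico I.1.1 I.1.2, starRingEnd 𝕜 (u x) * (w x : 𝕜)
  B := B
  Q := (a2Characteristic w).toReal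
  L_pos I := sub_pos.2 (D.lt_of_mem_intervals I.2)
  L_left I := by simp only [leftHalf]; ring
  L_right I := by simp only [rightHalf]; ring
  F_add I := integral_halves (D.lt_of_mem_intervals I.2)
    (hw.integrableOn_norm hf (D.lt_of_mem_intervals I.2)).1
  S_add I := integral_halves (D.lt_of_mem_intervals I.2)
    (hw.integrableOn_inv (D.lt_of_mem_intervals I.2)).1
  W_add I := integral_halves (D.lt_of_mem_intervals I.2) (hw.1.1.integrableOn_Ico _ _)
  X_add I := integral_halves (D.lt_of_mem_intervals I.2) (hw.1.integrable_sq_mul hf).integrableOn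
  Y_add I := integral_halves (D.lt_of_mem_intervals I.2) (hw.1.integrable_sq_mul hu).integrableOn
  A_add I := integral_halves (D.lt_of_mem_intervals I.2) (hw.1.integrableOn_norm_mul hu _ _).1
  γ_add I := integral_halves (D.lt_of_mem_intervals I.2) (hw.1.integrableOn_conj_mul hu _ _)
  V_add I := hb.sqOscillation_halves I.2
  F_nonneg I := integral_nonneg fun _ => norm_nonneg _
  A_nonneg I := integral_nonneg_of_ae (by
    filter_upwards [ae_restrict_of_ae hw.1.2] with x hx using
      mul_nonneg (norm_nonneg _) (le_of_lt hx))
  S_pos I := setIntegral_Ico_pos (D.lt_of_mem_intervals I.2)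
    (hw.integrableOn_inv (D.lt_of_mem_intervals I.2)).1
    (by filter_upwards [hw.1.2] with x hx using inv_pos.2 hx)
  W_pos I := setIntegral_Ico_pos (D.lt_of_mem_intervals I.2) (hw.1.1.integrableOn_Ico _ _) hw.1.2
  γ_le I := by
    refine norm_integral_le_of_norm_le (hw.1.integrableOn_norm_mul hu _ _).1 ?_
    filter_upwards [ae_restrict_of_ae hw.1.2] with x hx
    rw [norm_mul, RCLike.norm_conj, RCLike.norm_ofReal, abs_of_pos hx]
  F_sq I := (hw.integrableOn_norm hf (D.lt_of_mem_intervals I.2)).2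
  A_sq I := (hw.1.integrableOn_norm_mul hu _ _).2
  L_sq I := hw.sq_le (D.lt_of_mem_intervals I.2)
  SW_le I := (hw.integrableOn_inv (D.lt_of_mem_intervals I.2)).2
  V_nonneg I := sqOscillation_nonneg _ _
  V_le I := (hb.sqOscillation_le I.2).trans (by
    have := D.lt_of_mem_intervals I.2
    gcongr)

end testing

/-! ### From trees to arbitrary finite families of intervals -/

lemma Finset.sum_union_le_add {ι : Type*} [DecidableEq ι] {g : ι → ℝ} (hg : ∀ i, 0 ≤ g i)
    (s t : Finset ι) : ∑ i ∈ s ∪ t, g i ≤ ∑ i ∈ s, g i + ∑ i ∈ t, g i := by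
  rw [← Finset.sum_union_inter]
  exact le_add_of_nonneg_right (Finset.sum_nonneg fun i _ => hg i)

lemma Finset.sum_biUnion_le_sum_sum {κ ι : Type*} [DecidableEq ι] {g : ι → ℝ} (hg : ∀ i, 0 ≤ g i)
    (s : Finset κ) (t : κ → Finset ι) :
    ∑ i ∈ s.biUnion t, g i ≤ ∑ k ∈ s, ∑ i ∈ t k, g i := by
  classical
  induction s using Finset.induction_on with
  | empty => simp
  | insert k s hk ih =>
    rw [Finset.biUnion_insert, Finset.sum_insert hk]
    exact (Finset.sum_union_le_add hg _ _).trans (by gcongr)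

namespace WeightedTree

variable {𝕜 ι : Type*} [RCLike 𝕜] (T : WeightedTree 𝕜 ι)

/-- The contribution of a single node to `formSum`. -/
noncomputable def term (I : ι) : ℝ :=
  T.c I * (T.F I / T.L I) * (‖T.γ (T.right I) - T.γ (T.left I)‖ / √(T.L I))

lemma term_nonneg (hc : ∀ I, 0 ≤ T.c I) (I : ι) : 0 ≤ T.term I := by
  have := hc I
  have := T.F_nonneg I
  have := T.L_pos I
  rw [term]
  positivity

variable [DecidableEq ι]

/-- The finite tree of descendants of `I` of depth less than `n`. -/
noncomputable def nodes : ℕ → ι → Finset ι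
  | 0, _ => ∅
  | n + 1, I => insert I (nodes n (T.left I) ∪ nodes n (T.right I))

lemma nodes_subset_succ (n : ℕ) (I : ι) : T.nodes n I ⊆ T.nodes (n + 1) I := by
  induction n generalizing I with
  | zero => simp [nodes]
  | succ n ih =>
    rw [nodes, nodes]
    exact Finset.insert_subset_insert _ (Finset.union_subset_union (ih _) (ih _))

lemma nodes_mono (I : ι) : Monotone fun n => T.nodes n I :=
  monotone_nat_of_le_succ fun n => T.nodes_subset_succ n I

lemma sum_nodes_le (hc : ∀ I, 0 ≤ T.c I) (n : ℕ) (I : ι) :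
    ∑ J ∈ T.nodes n I, T.term J ≤ T.formSum n I := by
  have hun := Finset.sum_union_le_add (T.term_nonneg hc)
  induction n generalizing I with
  | zero => simp [nodes, formSum]
  | succ n ih =>
    have h1 := hun {I} (T.nodes n (T.left I) ∪ T.nodes n (T.right I))
    have h2 := hun (T.nodes n (T.left I)) (T.nodes n (T.right I))
    have h3 := ih (T.left I)
    have h4 := ih (T.right I)
    rw [Finset.sum_singleton] at h1
    have h5 : ∑ J ∈ T.nodes (n + 1) I, T.term J
        = ∑ J ∈ {I} ∪ (T.nodes n (T.left I) ∪ T.nodes n (T.right I)), T.term J := by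
      rw [nodes, Finset.insert_eq]
    rw [h5, formSum]
    simp only [term] at *
    linarith

end WeightedTree

lemma DyadicGrid.exists_parent (D : DyadicGrid) {j : ℤ} {I : ℝ × ℝ} (hI : I ∈ D.gen (j + 1)) :
    ∃ J ∈ D.gen j, I = leftHalf J ∨ I = rightHalf J := by
  have hlt := D.lt_of_mem _ I hI
  obtain ⟨J, ⟨hJ, hx⟩, -⟩ := D.partition j I.1
  refine ⟨J, hJ, ?_⟩
  rw [← Ico_leftHalf_union (D.lt_of_mem _ J hJ)] at hx
  rcases hx with hx | hx
  · exact Or.inl ((D.partition (j + 1) I.1).unique ⟨hI, le_rfl, hlt⟩ ⟨D.left_half_mem j J hJ, hx⟩)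
  · exact Or.inr ((D.partition (j + 1) I.1).unique ⟨hI, le_rfl, hlt⟩ ⟨D.right_half_mem j J hJ, hx⟩)

lemma DyadicGrid.disjoint_of_mem_gen (D : DyadicGrid) {j : ℤ} {I J : ℝ × ℝ} (hI : I ∈ D.gen j)
    (hJ : J ∈ D.gen j) (hne : I ≠ J) : Disjoint (Set.Ico I.1 I.2) (Set.Ico J.1 J.2) := by
  rw [Set.disjoint_left]
  intro x hx hx'
  exact hne ((D.partition j x).unique ⟨hI, hx⟩ ⟨hJ, hx'⟩)

lemma DyadicGrid.sum_integral_le (D : DyadicGrid) {j : ℤ} (F : Finset D.intervals)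
    (hF : ∀ I ∈ F, (I : ℝ × ℝ) ∈ D.gen j) {g : ℝ → ℝ} (hg : Integrable g)
    (hg0 : 0 ≤ᵐ[volume] g) :
    ∑ I ∈ F, ∫ x in Set.Ico I.1.1 I.1.2, g x ≤ ∫ x, g x := by
  rw [← integral_biUnion_finset F (fun _ _ => measurableSet_Ico) ?_ fun _ _ => hg.integrableOn]
  · exact setIntegral_le_integral hg hg0
  · intro I hI J hJ hne
    exact D.disjoint_of_mem_gen (hF I hI) (hF J hJ) (fun h => hne (Subtype.ext h))

section form

variable {𝕜 : Type*} [RCLike 𝕜] {D : DyadicGrid} {w : ℝ → ℝ} {b f u : ℝ → 𝕜}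

lemma exists_mem_nodes (T : WeightedTree 𝕜 D.intervals)
    (hl : ∀ I, (T.left I : ℝ × ℝ) = leftHalf I) (hr : ∀ I, (T.right I : ℝ × ℝ) = rightHalf I)
    (k : ℕ) {j : ℤ} (I : D.intervals) (hI : (I : ℝ × ℝ) ∈ D.gen (j + k)) :
    ∃ J : D.intervals, (J : ℝ × ℝ) ∈ D.gen j ∧ I ∈ T.nodes (k + 1) J := by
  induction k generalizing j with
  | zero => exact ⟨I, by simpa using hI, by simp [WeightedTree.nodes]⟩
  | succ k ih =>
    obtain ⟨J, hJ, hIJ⟩ := ih (j := j + 1) (by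
      rw [add_assoc, add_comm 1 (k : ℤ)]; exact_mod_cast hI)
    obtain ⟨P, hP, hJP⟩ := D.exists_parent hJ
    refine ⟨⟨P, Set.mem_iUnion.2 ⟨j, hP⟩⟩, hP, ?_⟩
    rw [WeightedTree.nodes, Finset.mem_insert, Finset.mem_union]
    right
    rcases hJP with h | h
    · left
      convert hIJ
      exact Subtype.ext ((hl _).trans h.symm)
    · right
      convert hIJ
      exact Subtype.ext ((hr _).trans h.symm)

/-- A finite family need not have a common ancestor in the grid, so several tops are allowed. Taking
them all in one generation makes distinct tops disjoint. -/
lemma exists_tops (T : WeightedTree 𝕜 D.intervals)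
    (hl : ∀ I, (T.left I : ℝ × ℝ) = leftHalf I) (hr : ∀ I, (T.right I : ℝ × ℝ) = rightHalf I)
    (F : Finset D.intervals) : ∃ (j : ℤ) (n : ℕ), ∀ I ∈ F, ∃ J : D.intervals,
      (J : ℝ × ℝ) ∈ D.gen j ∧ I ∈ T.nodes n J := by
  have h1 : ∀ I ∈ F, ∀ᶠ j : ℤ in atBot, ∃ n, ∃ J : D.intervals,
      (J : ℝ × ℝ) ∈ D.gen j ∧ I ∈ T.nodes n J := by
    intro I _
    obtain ⟨i, hi⟩ := Set.mem_iUnion.1 I.2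
    filter_upwards [eventually_le_atBot i] with j hj
    refine ⟨(i - j).toNat + 1, exists_mem_nodes T hl hr _ I ?_⟩
    rw [Int.toNat_of_nonneg (by omega)]
    simpa using hi
  obtain ⟨j, hj⟩ := ((eventually_all_finset F).2 h1).exists
  have h2 : ∀ I ∈ F, ∀ᶠ n : ℕ in atTop, ∃ J : D.intervals,
      (J : ℝ × ℝ) ∈ D.gen j ∧ I ∈ T.nodes n J := by
    intro I hI
    obtain ⟨m, J, hJ, hIJ⟩ := hj I hI
    filter_upwards [eventually_ge_atTop m] with n hn
    exact ⟨J, hJ, T.nodes_mono J hn hIJ⟩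
  obtain ⟨n, hn⟩ := ((eventually_all_finset F).2 h2).exists
  exact ⟨j, n, hn⟩

/-- The tree estimates are added by Cauchy–Schwarz over the disjoint tops, which does not worsen the
constant. -/
lemma sum_term_le (hb : MemDyadicBMO D b) (hw : IsA2Weight w)
    (hf : MemLp f 2 (weightMeasure w)) (hu : MemLp u 2 (weightMeasure w)) {B : ℝ} (hB0 : 0 < B)
    (hB : (bmoNorm D b).toReal ≤ B) (F : Finset D.intervals) :
    ∑ I ∈ F, (paraproductTree hb hw hf hu hB).term I ≤
      8 * B * (a2Characteristic w).toReal *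
        (√(∫ x, ‖f x‖ ^ 2 * w x) * √(∫ x, ‖u x‖ ^ 2 * w x)) := by
  set T := paraproductTree hb hw hf hu hB with hT
  have hc : ∀ I, 0 ≤ T.c I := fun I => norm_nonneg _
  obtain ⟨j, n, h⟩ := exists_tops T (fun _ => rfl) (fun _ => rfl) F
  choose! top htop htop' using h
  have hnn : ∀ {h : ℝ → 𝕜} (J : D.intervals), 0 ≤ ∫ x in Set.Ico J.1.1 J.1.2, ‖h x‖ ^ 2 * w x :=
    fun J => integral_nonneg_of_ae (by
      filter_upwards [ae_restrict_of_ae hw.1.2] with x hx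
      simp only [Pi.zero_apply]
      positivity)
  have hge : ∀ J ∈ F.image top, (J : ℝ × ℝ) ∈ D.gen j := by
    intro J hJ
    obtain ⟨I, hI, rfl⟩ := Finset.mem_image.1 hJ
    exact htop I hI
  have hsum : ∀ {h : ℝ → 𝕜}, MemLp h 2 (weightMeasure w) →
      ∑ J ∈ F.image top, ∫ x in Set.Ico J.1.1 J.1.2, ‖h x‖ ^ 2 * w x
        ≤ ∫ x, ‖h x‖ ^ 2 * w x := fun hh =>
    D.sum_integral_le _ hge (hw.1.integrable_sq_mul hh) (by
      filter_upwards [hw.1.2] with x hx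
      simp only [Pi.zero_apply]
      positivity)
  calc ∑ I ∈ F, T.term I
      ≤ ∑ I ∈ (F.image top).biUnion (T.nodes n), T.term I := by
        refine Finset.sum_le_sum_of_subset_of_nonneg ?_ fun I _ _ => T.term_nonneg hc I
        intro I hI
        exact Finset.mem_biUnion.2 ⟨top I, Finset.mem_image_of_mem _ hI, htop' I hI⟩
    _ ≤ ∑ J ∈ F.image top, ∑ I ∈ T.nodes n J, T.term I :=
        Finset.sum_biUnion_le_sum_sum (T.term_nonneg hc) _ _
    _ ≤ ∑ J ∈ F.image top, 8 * B * (a2Characteristic w).toReal * (√(T.X J) * √(T.Y J)) :=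
        Finset.sum_le_sum fun J _ => (T.sum_nodes_le hc n J).trans (T.formSum_le_sqrt hB0 n J)
    _ = 8 * B * (a2Characteristic w).toReal * ∑ J ∈ F.image top, √(T.X J) * √(T.Y J) := by
        rw [Finset.mul_sum]
    _ ≤ 8 * B * (a2Characteristic w).toReal *
        (√(∑ J ∈ F.image top, T.X J) * √(∑ J ∈ F.image top, T.Y J)) := by
        gcongr
        exact Real.sum_sqrt_mul_sqrt_le _ (fun J => hnn J) (fun J => hnn J)
    _ ≤ _ := by
        gcongr
        · exact hsum hf
        · exact hsum hu

end form

/-! ### Uniform bounds for partial sums -/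

section partialSums

variable {𝕜 : Type*} [RCLike 𝕜] {D : DyadicGrid} {w : ℝ → ℝ} {b f : ℝ → 𝕜}

lemma IsWeight.weightMeasure_Ico_ne_top (hw : IsWeight w) (s t : ℝ) :
    weightMeasure w (Set.Ico s t) ≠ ∞ := by
  rw [weightMeasure, withDensity_apply _ measurableSet_Ico]
  exact (hw.1.integrableOn_Ico s t).lintegral_lt_top.ne

lemma IsWeight.memLp_haar (hw : IsWeight w) (I : ℝ × ℝ) :
    MemLp (haar I) 2 (weightMeasure w) :=
  ((memLp_indicator_const 2 measurableSet_Ico (1 : ℝ)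
      (Or.inr (hw.weightMeasure_Ico_ne_top _ _))).sub
    (memLp_indicator_const 2 measurableSet_Ico (1 : ℝ)
      (Or.inr (hw.weightMeasure_Ico_ne_top _ _)))).const_mul _

lemma IsWeight.memLp_paraproductTerm (hw : IsWeight w) (b f : ℝ → 𝕜) (I : ℝ × ℝ) :
    MemLp (paraproductTerm b f I) 2 (weightMeasure w) :=
  (hw.memLp_haar I).ofReal.const_mul _

lemma IsWeight.memLp_partialSum (hw : IsWeight w) (b f : ℝ → 𝕜) (F : Finset D.intervals) :
    MemLp (fun x => ∑ I ∈ F, paraproductTerm b f (I : ℝ × ℝ) x) 2 (weightMeasure w) :=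
  memLp_finsetSum F fun I _ => hw.memLp_paraproductTerm b f I

lemma norm_avg_le {I : ℝ × ℝ} (hI : I.1 < I.2) (f : ℝ → 𝕜) :
    ‖avg f I‖ ≤ (∫ x in Set.Ico I.1 I.2, ‖f x‖) / (I.2 - I.1) := by
  have hL : 0 < I.2 - I.1 := sub_pos.2 hI
  rw [avg_eq hI, norm_mul, RCLike.norm_ofReal, abs_of_pos (inv_pos.2 hL), div_eq_inv_mul]
  gcongr
  exact norm_integral_le_integral_norm _

/-- Duality with the partial sum as its own test function: expanding one factor of `u ū w` turns the
integral into a sum of Haar pairings with `G = ū w`. -/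
lemma integral_sq_partialSum_le (hb : MemDyadicBMO D b) (hw : IsA2Weight w)
    (hf : MemLp f 2 (weightMeasure w)) {B : ℝ} (hB : (bmoNorm D b).toReal ≤ B)
    (F : Finset D.intervals) :
    ∫ x, ‖∑ I ∈ F, paraproductTerm b f (I : ℝ × ℝ) x‖ ^ 2 * w x ≤
      ∑ I ∈ F, (paraproductTree hb hw hf (hw.1.memLp_partialSum b f F) hB).term I := by
  set u : ℝ → 𝕜 := fun x => ∑ I ∈ F, paraproductTerm b f (I : ℝ × ℝ) x with hu
  have hu2 : MemLp u 2 (weightMeasure w) := hw.1.memLp_partialSum b f F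
  set g : ℝ → 𝕜 := fun x => starRingEnd 𝕜 (u x) * (w x : 𝕜) with hg
  have hgi : ∀ I : D.intervals, IntegrableOn g (Set.Ico I.1.1 I.1.2) := fun I =>
    hw.1.integrableOn_conj_mul hu2 _ _
  have e1 : ∀ x, ((‖u x‖ ^ 2 * w x : ℝ) : 𝕜)
      = ∑ I ∈ F, avg f I.1 * haarCoeff b I.1 * (g x * (haar I.1 x : 𝕜)) := by
    intro x
    rw [RCLike.ofReal_mul, RCLike.ofReal_pow, ← RCLike.mul_conj]
    conv_lhs => rw [mul_assoc, hu]
    simp only [Finset.sum_mul, paraproductTerm]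
    refine Finset.sum_congr rfl fun I _ => ?_
    simp only [hg, hu, paraproductTerm]
    ring
  have e2 : ((∫ x, ‖u x‖ ^ 2 * w x : ℝ) : 𝕜) = ∑ I ∈ F, avg f I.1 * haarCoeff b I.1 *
      (((√(I.1.2 - I.1.1))⁻¹ : ℝ) * ((∫ x in Set.Ico (rightHalf I).1 (rightHalf I).2, g x) -
        ∫ x in Set.Ico (leftHalf I).1 (leftHalf I).2, g x)) := by
    rw [← integral_ofReal]
    simp only [e1]
    rw [integral_finsetSum]
    · refine Finset.sum_congr rfl fun I _ => ?_
      rw [integral_const_mul, integral_mul_haar (D.lt_of_mem_intervals I.2) (hgi I)]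
    · intro I _
      exact (integrable_mul_haar (D.lt_of_mem_intervals I.2) (hgi I)).const_mul _
  have e3 : ∫ x, ‖u x‖ ^ 2 * w x ≤ ‖((∫ x, ‖u x‖ ^ 2 * w x : ℝ) : 𝕜)‖ := by
    rw [RCLike.norm_ofReal]
    exact le_abs_self _
  refine e3.trans ?_
  rw [e2]
  refine (norm_sum_le _ _).trans (Finset.sum_le_sum fun I _ => ?_)
  have hI := D.lt_of_mem_intervals I.2
  have hL : 0 < I.1.2 - I.1.1 := sub_pos.2 hI
  have h := norm_avg_le hI f
  rw [norm_mul, norm_mul, norm_mul, RCLike.norm_ofReal, abs_of_nonneg (by positivity)]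
  change _ ≤ ‖haarCoeff b I‖ * ((∫ x in Set.Ico I.1.1 I.1.2, ‖f x‖) / (I.1.2 - I.1.1)) *
    (‖(∫ x in Set.Ico (rightHalf I).1 (rightHalf I).2, g x) -
        ∫ x in Set.Ico (leftHalf I).1 (leftHalf I).2, g x‖ / √(I.1.2 - I.1.1))
  rw [mul_comm ‖avg f _‖, inv_mul_eq_div]
  gcongr

lemma sqrt_integral_sq_partialSum_le (hb : MemDyadicBMO D b) (hw : IsA2Weight w)
    (hf : MemLp f 2 (weightMeasure w)) (F : Finset D.intervals) :
    √(∫ x, ‖∑ I ∈ F, paraproductTerm b f (I : ℝ × ℝ) x‖ ^ 2 * w x) ≤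
      8 * (a2Characteristic w).toReal * (bmoNorm D b).toReal * √(∫ x, ‖f x‖ ^ 2 * w x) := by
  -- The tree estimate divides by `B`, while the BMO norm may vanish; hence `B` is the norm plus
  -- `ε`.
  have key : ∀ ε : ℝ, 0 < ε → √(∫ x, ‖∑ I ∈ F, paraproductTerm b f (I : ℝ × ℝ) x‖ ^ 2 * w x) ≤
      8 * (a2Characteristic w).toReal * ((bmoNorm D b).toReal + ε) *
        √(∫ x, ‖f x‖ ^ 2 * w x) := by
    intro ε hε
    have hB : (bmoNorm D b).toReal ≤ (bmoNorm D b).toReal + ε := by linarith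
    have hB0 : 0 < (bmoNorm D b).toReal + ε := by positivity
    have h := (integral_sq_partialSum_le hb hw hf hB F).trans
      (sum_term_le hb hw hf (hw.1.memLp_partialSum b f F) hB0 hB F)
    have hN0 : 0 ≤ ∫ x, ‖∑ I ∈ F, paraproductTerm b f (I : ℝ × ℝ) x‖ ^ 2 * w x :=
      integral_nonneg_of_ae (by
        filter_upwards [hw.1.2] with x hx
        simp only [Pi.zero_apply]
        positivity)
    rcases (Real.sqrt_nonneg
      (∫ x, ‖∑ I ∈ F, paraproductTerm b f (I : ℝ × ℝ) x‖ ^ 2 * w x)).eq_or_lt with h0 | h0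
    · rw [← h0]
      positivity
    · refine le_of_mul_le_mul_right ?_ h0
      rw [Real.mul_self_sqrt hN0]
      linarith
  have ht : Tendsto (fun ε : ℝ => 8 * (a2Characteristic w).toReal * ((bmoNorm D b).toReal + ε) *
      √(∫ x, ‖f x‖ ^ 2 * w x)) (𝓝[>] 0) (𝓝 (8 * (a2Characteristic w).toReal *
        ((bmoNorm D b).toReal + 0) * √(∫ x, ‖f x‖ ^ 2 * w x))) := by
    apply Tendsto.mono_left _ nhdsWithin_le_nhds
    exact Continuous.tendsto (by fun_prop) 0
  rw [add_zero] at ht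
  exact ge_of_tendsto ht (eventually_mem_nhdsWithin.mono fun ε hε => key ε hε)

lemma eLpNorm_partialSum_le (hb : MemDyadicBMO D b) (hw : IsA2Weight w)
    (hf : MemLp f 2 (weightMeasure w)) (F : Finset D.intervals) :
    eLpNorm (fun x => ∑ I ∈ F, paraproductTerm b f (I : ℝ × ℝ) x) 2 (weightMeasure w) ≤
      8 * a2Characteristic w * bmoNorm D b * eLpNorm f 2 (weightMeasure w) := by
  rw [hw.1.eLpNorm_eq hf, hw.1.eLpNorm_eq (hw.1.memLp_partialSum b f F)]
  refine (ENNReal.ofReal_le_ofReal (sqrt_integral_sq_partialSum_le hb hw hf F)).trans (le_of_eq ?_)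
  rw [ENNReal.ofReal_mul (by positivity), ENNReal.ofReal_mul (by positivity),
    ENNReal.ofReal_mul (by positivity), ENNReal.ofReal_toReal hw.2.ne,
    ENNReal.ofReal_toReal hb.2.ne]
  norm_num

end partialSums

/-! ### Unconditional convergence and the main theorem -/

/-- In a Hilbert space, a series with bounded finite partial sums converges unconditionally. -/
theorem summable_of_norm_sum_le {𝕜 E ι : Type*} [RCLike 𝕜] [NormedAddCommGroup E]
    [InnerProductSpace 𝕜 E] [CompleteSpace E] {x : ι → E} {C : ℝ}
    (hC : ∀ s : Finset ι, ‖∑ i ∈ s, x i‖ ≤ C) : Summable x := by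
  classical
  rw [summable_iff_vanishing_norm]
  by_contra hcon
  push Not at hcon
  obtain ⟨ε, hε, hcon⟩ := hcon
  -- If the Cauchy criterion fails, there are always new disjoint blocks of norm at least `ε`. Their
  -- signs are chosen greedily: by the parallelogram law one of `d ± y` has squared norm at least
  -- `‖d‖² + ‖y‖²`. The signed sums grow without bound, yet each is a difference of two partial
  -- sums.
  have key : ∀ n : ℕ, ∃ s A : Finset ι, Disjoint s A ∧
      n * ε ^ 2 ≤ ‖∑ i ∈ s, x i - ∑ i ∈ A, x i‖ ^ 2 := by
    intro n
    induction n with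
    | zero => exact ⟨∅, ∅, by simp, by simp⟩
    | succ n ih =>
      obtain ⟨s, A, hd, h⟩ := ih
      obtain ⟨t, ht, hεt⟩ := hcon (s ∪ A)
      rw [Finset.disjoint_union_right] at ht
      set d := ∑ i ∈ s, x i - ∑ i ∈ A, x i with hd'
      set y := ∑ i ∈ t, x i with hy
      have hp := parallelogram_law_with_norm 𝕜 d y
      have hsq : ε ^ 2 ≤ ‖y‖ ^ 2 := by gcongr
      rcases le_total (‖d - y‖) (‖d + y‖) with hle | hle
      · refine ⟨s ∪ t, A, Finset.disjoint_union_left.2 ⟨hd, ht.2⟩, ?_⟩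
        rw [Finset.sum_union ht.1.symm, ← hy,
          show ∑ i ∈ s, x i + y - ∑ i ∈ A, x i = d + y by rw [hd']; abel]
        push_cast
        nlinarith [norm_nonneg (d - y)]
      · refine ⟨s, A ∪ t, Finset.disjoint_union_right.2 ⟨hd, ht.1.symm⟩, ?_⟩
        rw [Finset.sum_union ht.2.symm, ← hy,
          show ∑ i ∈ s, x i - (∑ i ∈ A, x i + y) = d - y by rw [hd']; abel]
        push_cast
        nlinarith [norm_nonneg (d + y)]
  obtain ⟨n, hn⟩ := exists_nat_gt ((2 * C) ^ 2 / ε ^ 2)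
  obtain ⟨s, A, -, h⟩ := key n
  rw [div_lt_iff₀ (by positivity)] at hn
  have h1 : ‖∑ i ∈ s, x i - ∑ i ∈ A, x i‖ ≤ 2 * C :=
    (norm_sub_le _ _).trans (by linarith [hC s, hC A])
  have h2 : ‖∑ i ∈ s, x i - ∑ i ∈ A, x i‖ ^ 2 ≤ (2 * C) ^ 2 := by gcongr
  linarith

theorem exists_isParaproduct {𝕜 : Type*} [RCLike 𝕜] {D : DyadicGrid} {w : ℝ → ℝ} {b f : ℝ → 𝕜}
    (hb : MemDyadicBMO D b) (hw : IsA2Weight w) (hf : MemLp f 2 (weightMeasure w)) :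
    ∃ T : ℝ → 𝕜, IsParaproduct D w b f T := by
  set p : D.intervals → Lp 𝕜 2 (weightMeasure w) := fun I =>
    (hw.1.memLp_paraproductTerm b f I).toLp _ with hp
  have hsum : ∀ F : Finset D.intervals,
      ∑ I ∈ F, p I = (hw.1.memLp_partialSum b f F).toLp _ := by
    intro F
    rw [Lp.ext_iff]
    refine (Lp.coeFn_finsetSum F p).trans (EventuallyEq.trans ?_ (MemLp.coeFn_toLp _).symm)
    have h : ∀ I ∈ F, ∀ᵐ x ∂(weightMeasure w), p I x = paraproductTerm b f I x :=
      fun I _ => MemLp.coeFn_toLp _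
    filter_upwards [(eventually_all_finset F).2 h] with x hx
    rw [Finset.sum_apply]
    exact Finset.sum_congr rfl hx
  have hS : Summable p := by
    refine summable_of_norm_sum_le (𝕜 := 𝕜) (C := (8 * a2Characteristic w * bmoNorm D b *
      eLpNorm f 2 (weightMeasure w)).toReal) fun F => ?_
    rw [hsum, Lp.norm_toLp]
    refine ENNReal.toReal_mono ?_ (eLpNorm_partialSum_le hb hw hf F)
    exact ENNReal.mul_ne_top (ENNReal.mul_ne_top (ENNReal.mul_ne_top (by simp) hw.2.ne) hb.2.ne)
      hf.2.ne
  obtain ⟨a, ha⟩ := hS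
  refine ⟨a, Lp.memLp a, ?_⟩
  have h1 : Tendsto (fun F : Finset D.intervals => ‖a - ∑ I ∈ F, p I‖ₑ) atTop (𝓝 0) := by
    have : Tendsto (fun F : Finset D.intervals => a - ∑ I ∈ F, p I) atTop (𝓝 (a - a)) :=
      tendsto_const_nhds.sub ha
    simpa using this.enorm
  refine h1.congr fun F => ?_
  rw [Lp.enorm_def]
  apply eLpNorm_congr_ae
  filter_upwards [Lp.coeFn_sub a (∑ I ∈ F, p I),
    (Lp.ext_iff.1 (hsum F)).trans (MemLp.coeFn_toLp _)] with x h2 h3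
  rw [h2, Pi.sub_apply, h3]

theorem mainTheorem1 {𝕜 : Type*} [RCLike 𝕜] (D : DyadicGrid) (b : ℝ → 𝕜) (hb : MemDyadicBMO D b)
    (w : ℝ → ℝ) (hw : IsA2Weight w) (f : ℝ → 𝕜) (hf : MemLp f 2 (weightMeasure w)) :
    (∃ T : ℝ → 𝕜, IsParaproduct D w b f T) ∧
      ∀ T : ℝ → 𝕜, IsParaproduct D w b f T →
        eLpNorm T 2 (weightMeasure w) ≤
          8 * a2Characteristic w * bmoNorm D b * eLpNorm f 2 (weightMeasure w) := by
  refine ⟨exists_isParaproduct hb hw hf, fun T hT => ?_⟩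
  have h : ∀ F : Finset D.intervals, eLpNorm T 2 (weightMeasure w) ≤
      eLpNorm (fun x => T x - ∑ I ∈ F, paraproductTerm b f (I : ℝ × ℝ) x) 2 (weightMeasure w) +
        8 * a2Characteristic w * bmoNorm D b * eLpNorm f 2 (weightMeasure w) := by
    intro F
    have hF := hw.1.memLp_partialSum b f F
    have h1 := eLpNorm_add_le (hT.1.sub hF).1 hF.1 one_le_two
    rw [sub_add_cancel] at h1
    exact h1.trans (add_le_add le_rfl (eLpNorm_partialSum_le hb hw hf F))
  have ht := hT.2.add_const (8 * a2Characteristic w * bmoNorm D b *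
    eLpNorm f 2 (weightMeasure w))
  rw [zero_add] at ht
  exact ge_of_tendsto' ht h
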